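/- Let $P_1,P_2,Q\ge 0$. Consider the memoryless channel $Y=X_1+X_2+S+Z$ with state $S\sim\mathcal N(0,Q)$ and noise $Z\sim\mathcal N(0,1)$, where $S$ and $Z$ are independent of each other and i.i.d. over channel uses. A code of length $n$ with message sets $\{1,\dots,N_1\}$, $\{1,\dots,N_2\}$ consists of (measurable) maps $x_1^n(m_1,s^n)$, $x_2^n(m_2)$ and a decoder $y^n\mapsto(\hat m_1,\hat m_2)$; so encoder 1 knows its message and the whole state sequence, encoder 2 only its own message, and the decoder only the output sequence. With $M_1,M_2$ independent, uniform, and independent of $(S^n,Z^n)$, the code must satisfy $\sum_{i=1}^n\mathbb E[X_{1,i}^2(M_1,S^n)]\le nP_1$ and $\sum_{i=1}^n\mathbb E[X_{2,i}^2(M_2)]\le nP_2$, and its error probability is $\mathbb P[(\hat M_1,\hat M_2)\ne(M_1,M_2)]$. A pair $(R_1,R_2)$ of nonnegative rates is achievable if there are such codes for every $n$ with $N_1\ge e^{nR_1}$, $N_2\ge e^{nR_2}$ and error probability tending to $0$ as $n\to\infty$. The capacity region $\mathcal C(P_1,P_2,Q)$ (without degraded message sets) is the closure of the set of achievable pairs.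 Then for every $(R_1,R_2)\in\mathcal C(P_1,P_2,Q)$ there is a joint law of $(S,X_1,X_2)$ of the form $P_SP_{X_1|S}P_{X_2}$ with $P_S=\mathcal N(0,Q)$, $\mathbb E[X_1^2]\le P_1$ and $\mathbb E[X_2^2]\le P_2$, such that, with $Y=X_1+X_2+S+Z$ and $Z\sim\mathcal N(0,1)$ independent of $(S,X_1,X_2)$, $$R_1\le I(X_1;Y\mid X_2,S),\qquad R_2\le I(X_2;Y\mid X_1,S),\qquad R_1+R_2\le I(X_1;Y\mid X_2,S)+I(X_2;Y),$$ where mutual information is measured in nats. -/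

import Mathlib

open MeasureTheory ProbabilityTheory InformationTheory Filter Topology
open scoped NNReal ENNReal

noncomputable section

namespace DirtyMAC

/-- Mutual information `I(X;Y)` in nats: the relative entropy between the joint law of `(X, Y)` and
the product of the marginal laws. -/
def mutualInfo {Ω α β : Type*} [MeasurableSpace Ω] [MeasurableSpace α] [MeasurableSpace β]
    (X : Ω → α) (Y : Ω → β) (μ : Measure Ω) : ℝ≥0∞ :=
  klDiv (μ.map fun ω => (X ω, Y ω)) ((μ.map X).prod (μ.map Y))

/-- Conditional mutual information `I(X;Y|W)` in nats: the relative entropy between the joint law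
`P_{W,X,Y}` and `P_W P_{X|W} P_{Y|W}`. -/
def condMutualInfo {Ω α β γ : Type*} [MeasurableSpace Ω]
    [MeasurableSpace α] [StandardBorelSpace α] [Nonempty α]
    [MeasurableSpace β] [StandardBorelSpace β] [Nonempty β] [MeasurableSpace γ]
    (X : Ω → α) (Y : Ω → β) (W : Ω → γ) (μ : Measure Ω) [IsFiniteMeasure μ] : ℝ≥0∞ :=
  klDiv (μ.map fun ω => (W ω, X ω, Y ω))
    ((μ.map W) ⊗ₘ (condDistrib X W μ ×ₖ condDistrib Y W μ))

/-- A block code of length `n` with message sets `Fin N₁`, `Fin N₂` (without degraded message sets).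
Encoder 1 knows its message and the whole state sequence, encoder 2 only its own message, and the
decoder only the channel output sequence. -/
structure Code (n N₁ N₂ : ℕ) where
  enc₁ : Fin N₁ → (Fin n → ℝ) → Fin n → ℝ
  measurable_enc₁ : ∀ m, Measurable (enc₁ m)
  enc₂ : Fin N₂ → Fin n → ℝ
  dec : (Fin n → ℝ) → Fin N₁ × Fin N₂
  measurable_dec : Measurable dec

/-- Sample space of one block transmission: the messages `(M₁, M₂)`, then the state sequence `Sⁿ`
and the noise sequence `Zⁿ`. -/
abbrev Sample (n N₁ N₂ : ℕ) : Type :=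
  (Fin N₁ × Fin N₂) × ((Fin n → ℝ) × (Fin n → ℝ))

/-- Law of `((M₁, M₂), (Sⁿ, Zⁿ))`: all four are independent, the messages are uniform, the state is
i.i.d. `N(0, Q)` and the noise is i.i.d. `N(0, 1)`. -/
def blockLaw (n N₁ N₂ : ℕ) (Q : ℝ≥0) : Measure (Sample n N₁ N₂) :=
  ((uniformOn (Set.univ : Set (Fin N₁))).prod (uniformOn (Set.univ : Set (Fin N₂)))).prod
    ((Measure.pi fun _ : Fin n => gaussianReal 0 Q).prod
      (Measure.pi fun _ : Fin n => gaussianReal 0 1))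

namespace Code

variable {n N₁ N₂ : ℕ}

/-- The channel input sequence of encoder 1. -/
def input₁ (c : Code n N₁ N₂) (ω : Sample n N₁ N₂) : Fin n → ℝ := c.enc₁ ω.1.1 ω.2.1

/-- The channel input sequence of encoder 2. -/
def input₂ (c : Code n N₁ N₂) (ω : Sample n N₁ N₂) : Fin n → ℝ := c.enc₂ ω.1.2

/-- The channel output sequence `Yᵢ = X₁ᵢ + X₂ᵢ + Sᵢ + Zᵢ`. -/
def output (c : Code n N₁ N₂) (ω : Sample n N₁ N₂) : Fin n → ℝ :=
  fun i => c.input₁ ω i + c.input₂ ω i + ω.2.1 i + ω.2.2 i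

/-- The average power constraints `∑ᵢ E[X₁ᵢ²] ≤ n P₁` and `∑ᵢ E[X₂ᵢ²] ≤ n P₂`. -/
def SatisfiesPower (c : Code n N₁ N₂) (P₁ P₂ Q : ℝ≥0) : Prop :=
  ∑ i, ∫⁻ ω, ENNReal.ofReal (c.input₁ ω i ^ 2) ∂(blockLaw n N₁ N₂ Q) ≤ n * P₁ ∧
  ∑ i, ∫⁻ ω, ENNReal.ofReal (c.input₂ ω i ^ 2) ∂(blockLaw n N₁ N₂ Q) ≤ n * P₂

/-- The average probability that the decoded message pair differs from the transmitted one. -/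
def errorProb (c : Code n N₁ N₂) (Q : ℝ≥0) : ℝ≥0∞ :=
  blockLaw n N₁ N₂ Q {ω | c.dec (c.output ω) ≠ ω.1}

end Code

/-- A rate pair (in nats per channel use) is achievable if there are codes of all block lengths `n`,
with at least `exp (n R₁)` and `exp (n R₂)` messages, that satisfy the power constraints and whose
average error probability tends to zero. -/
def Achievable (P₁ P₂ Q : ℝ≥0) (R₁ R₂ : ℝ) : Prop :=
  0 ≤ R₁ ∧ 0 ≤ R₂ ∧
  ∃ (N₁ N₂ : ℕ → ℕ) (c : ∀ n, Code n (N₁ n) (N₂ n)),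
    (∀ n : ℕ, Real.exp (n * R₁) ≤ N₁ n ∧ Real.exp (n * R₂) ≤ N₂ n ∧
      (c n).SatisfiesPower P₁ P₂ Q) ∧
    Tendsto (fun n => (c n).errorProb Q) atTop (𝓝 0)

/-- The capacity region: the closure of the set of achievable rate pairs. -/
def capacityRegion (P₁ P₂ Q : ℝ≥0) : Set (ℝ × ℝ) :=
  closure {R | Achievable P₁ P₂ Q R.1 R.2}

/-- The law of `(S, X₁, X₂, Z)` for a single channel use with joint input law `P_S P_{X₁|S} P_{X₂}`,
where `S ∼ N(0, Q)`, `P_{X₁|S} = κ`, `P_{X₂} = ν`, and the noise `Z ∼ N(0, 1)` is independent of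
`(S, X₁, X₂)`. -/
def letterLaw (Q : ℝ≥0) (κ : Kernel ℝ ℝ) (ν : Measure ℝ) : Measure (((ℝ × ℝ) × ℝ) × ℝ) :=
  (((gaussianReal 0 Q) ⊗ₘ κ).prod ν).prod (gaussianReal 0 1)

instance (Q : ℝ≥0) (κ : Kernel ℝ ℝ) [IsMarkovKernel κ] (ν : Measure ℝ) [IsProbabilityMeasure ν] :
    IsProbabilityMeasure (letterLaw Q κ ν) := by
  unfold letterLaw; infer_instance

/-- The state `S` of a single channel use. -/
def state (ω : ((ℝ × ℝ) × ℝ) × ℝ) : ℝ := ω.1.1.1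

/-- The input `X₁` of a single channel use. -/
def inp₁ (ω : ((ℝ × ℝ) × ℝ) × ℝ) : ℝ := ω.1.1.2

/-- The input `X₂` of a single channel use. -/
def inp₂ (ω : ((ℝ × ℝ) × ℝ) × ℝ) : ℝ := ω.1.2

/-- The noise `Z` of a single channel use. -/
def noise (ω : ((ℝ × ℝ) × ℝ) × ℝ) : ℝ := ω.2

/-- The output `Y = X₁ + X₂ + S + Z` of a single channel use. -/
def out (ω : ((ℝ × ℝ) × ℝ) × ℝ) : ℝ := inp₁ ω + inp₂ ω + state ω + noise ω

/-- The single-letter region: rate pairs for which some joint law `P_S P_{X₁|S} P_{X₂}` obeying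
`E[X₁²] ≤ P₁` and `E[X₂²] ≤ P₂` satisfies all three mutual information bounds. -/
def outerRegion (P₁ P₂ Q : ℝ≥0) : Set (ℝ × ℝ) :=
  {R | 0 ≤ R.1 ∧ 0 ≤ R.2 ∧
    ∃ (κ : Kernel ℝ ℝ) (_ : IsMarkovKernel κ) (ν : Measure ℝ) (_ : IsProbabilityMeasure ν),
      ∫⁻ ω, ENNReal.ofReal (inp₁ ω ^ 2) ∂(letterLaw Q κ ν) ≤ P₁ ∧
      ∫⁻ ω, ENNReal.ofReal (inp₂ ω ^ 2) ∂(letterLaw Q κ ν) ≤ P₂ ∧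
      ENNReal.ofReal R.1 ≤
        condMutualInfo inp₁ out (fun ω => (inp₂ ω, state ω)) (letterLaw Q κ ν) ∧
      ENNReal.ofReal R.2 ≤
        condMutualInfo inp₂ out (fun ω => (inp₁ ω, state ω)) (letterLaw Q κ ν) ∧
      ENNReal.ofReal (R.1 + R.2) ≤
        condMutualInfo inp₁ out (fun ω => (inp₂ ω, state ω)) (letterLaw Q κ ν) +
          mutualInfo inp₂ out (letterLaw Q κ ν)}

end DirtyMAC

end

/-!
If an event has probability `p` under `μ` and at most `1 / N` under a reference law `ν`, then
`p * log N ≤ KL(μ, ν) + 1`. Applied to correct decoding, with a reference law under which the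
decoder has to guess one of `N` messages blindly, this bounds `log N` by a relative entropy, up to
the factor `p` and the constant `1`, both harmless after division by the blocklength. Taking
Gaussian reference laws makes the bound depend only on second moments of the inputs, that is on
their energies and on the correlation `ρ` of the first input with the state.

For the individual rates the reference law keeps the state and the other message and redraws the
output. For the sum rate it draws a Gaussian output independent of both messages and then redraws
the state around its linear estimate from the output and the messages; the two variances combine to
`log (1 + P₁ - ρ²) + log (1 + P₂ / (1 + P₁ - ρ² + (ρ + √Q)²))`. As `ρ` ranges over a compact
interval these bounds cut out a closed set, so they pass to the capacity region, and each of them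
is attained by the Gaussian inputs `X₁ = a S + G` and `X₂ ∼ N(0, P₂)`.
-/

noncomputable section

namespace DirtyMAC

section LogDensity

variable {α β : Type*} [MeasurableSpace α] [MeasurableSpace β]

lemma measureReal_mul_log_le_toReal_klDiv {μ ν : Measure α} [IsProbabilityMeasure μ]
    [IsProbabilityMeasure ν] (h : klDiv μ ν ≠ ∞) {A : Set α} (hA : MeasurableSet A) {N : ℝ}
    (hN : 1 ≤ N) (hνA : N * ν.real A ≤ 1) :
    μ.real A * Real.log N ≤ (klDiv μ ν).toReal + 1 := by
  obtain ⟨hac, hint⟩ := klDiv_ne_top_iff.1 h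
  let r : α → ℝ := fun x => (ν.rnDeriv μ x).toReal
  have hr : Integrable r μ := Measure.integrable_toReal_rnDeriv
  have hr_univ : ∫ x, r x ∂μ ≤ 1 := by
    simpa using Measure.setIntegral_toReal_rnDeriv_le (ν := μ) (measure_ne_top ν Set.univ)
  have hr_A : N * ∫ x in A, r x ∂μ ≤ 1 :=
    (mul_le_mul_of_nonneg_left (Measure.setIntegral_toReal_rnDeriv_le (measure_ne_top ν A))
      (by positivity)).trans hνA
  -- `u + 1 ≤ exp u` at `u = log N - llr μ ν` on `A` and at `u = -llr μ ν` off `A`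
  have hpt : ∀ᵐ x ∂μ, A.indicator (fun _ => Real.log N) x - llr μ ν x ≤
      A.indicator (fun x => N * r x) x + r x - 1 := by
    filter_upwards [exp_neg_llr hac] with x hx
    have hrx : Real.exp (-llr μ ν x) = r x := hx
    by_cases hxA : x ∈ A
    · have h := Real.add_one_le_exp (Real.log N + -llr μ ν x)
      rw [Real.exp_add, Real.exp_log (by positivity), hrx] at h
      have hr0 : 0 ≤ r x := ENNReal.toReal_nonneg
      simp only [Set.indicator_of_mem hxA]
      linarith
    · simp only [Set.indicator_of_notMem hxA]
      linarith [Real.add_one_le_exp (-llr μ ν x)]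
  have hlog : Integrable (A.indicator fun _ => Real.log N) μ := (integrable_const _).indicator hA
  have hNr : Integrable (A.indicator fun x => N * r x) μ := (hr.const_mul N).indicator hA
  have key := integral_mono_ae (hlog.sub hint) ((hNr.add hr).sub (integrable_const (1 : ℝ))) hpt
  rw [integral_sub' hlog hint, integral_sub' (hNr.add hr) (integrable_const _),
    integral_add' hNr hr, integral_indicator hA, integral_indicator hA, integral_const_mul,
    setIntegral_const, integral_const, smul_eq_mul, probReal_univ, one_smul] at key
  rw [toReal_klDiv_of_measure_eq hac (by simp)]
  linarith

/-- The measure with density `exp a` with respect to `Λ`. Densities are kept in logarithmic form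
because relative entropies and products of densities are then sums. -/
def withLogDensity (Λ : Measure α) (a : α → ℝ) : Measure α :=
  Λ.withDensity fun x => ENNReal.ofReal (Real.exp (a x))

variable {Λ : Measure α} {Λ' : Measure β} {a b : α → ℝ} {c : β → ℝ}

lemma lintegral_withLogDensity (ha : Measurable a) {F : α → ℝ≥0∞} (hF : Measurable F) :
    ∫⁻ x, F x ∂(withLogDensity Λ a) = ∫⁻ x, ENNReal.ofReal (Real.exp (a x)) * F x ∂Λ :=
  lintegral_withDensity_eq_lintegral_mul _ (by fun_prop) hF

lemma withLogDensity_withLogDensity (ha : Measurable a) (hb : Measurable b) :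
    withLogDensity (withLogDensity Λ a) b = withLogDensity Λ fun x => a x + b x := by
  rw [withLogDensity, withLogDensity, ← withDensity_mul _ (by fun_prop) (by fun_prop)]
  simp only [withLogDensity, Real.exp_add, ENNReal.ofReal_mul (Real.exp_pos _).le]
  rfl

lemma prod_withLogDensity [SFinite Λ'] (hc : Measurable c) :
    Λ.prod (withLogDensity Λ' c) = withLogDensity (Λ.prod Λ') fun p => c p.2 :=
  prod_withDensity_right (by fun_prop)

lemma withLogDensity_prod [SFinite Λ'] (ha : Measurable a) :
    (withLogDensity Λ a).prod Λ' = withLogDensity (Λ.prod Λ') fun p => a p.1 :=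
  prod_withDensity_left (by fun_prop)

lemma map_withLogDensity {Φ : α → β} (hΦ : MeasurePreserving Φ Λ Λ') (hc : Measurable c) :
    (withLogDensity Λ (c ∘ Φ)).map Φ = withLogDensity Λ' c := by
  refine Measure.ext fun s hs => ?_
  rw [Measure.map_apply hΦ.measurable hs, withLogDensity, withLogDensity,
    withDensity_apply _ (hΦ.measurable hs), withDensity_apply _ hs]
  exact hΦ.setLIntegral_comp_preimage hs hc.exp.ennreal_ofReal

instance [SFinite Λ] : SFinite (withLogDensity Λ a) := by unfold withLogDensity; infer_instance

lemma withLogDensity_sub_withLogDensity (ha : Measurable a) (hb : Measurable b) :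
    withLogDensity (withLogDensity Λ b) (fun x => a x - b x) = withLogDensity Λ a := by
  rw [withLogDensity_withLogDensity hb (by fun_prop)]
  simp only [add_sub_cancel]

lemma withLogDensity_absolutelyContinuous (ha : Measurable a) (hb : Measurable b) :
    withLogDensity Λ a ≪ withLogDensity Λ b := by
  rw [← withLogDensity_sub_withLogDensity ha hb]
  exact withDensity_absolutelyContinuous _ _

lemma llr_withLogDensity [SigmaFinite (withLogDensity Λ b)] (ha : Measurable a)
    (hb : Measurable b) : llr (withLogDensity Λ a) (withLogDensity Λ b) =ᵐ[withLogDensity Λ a]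
      fun x => a x - b x := by
  have hrn := Measure.rnDeriv_withDensity (withLogDensity Λ b)
    (f := fun x => ENNReal.ofReal (Real.exp (a x - b x))) (by fun_prop)
  filter_upwards [(withLogDensity_absolutelyContinuous ha hb).ae_le hrn] with x hx
  rw [← withLogDensity, withLogDensity_sub_withLogDensity ha hb] at hx
  rw [llr, hx, ENNReal.toReal_ofReal (Real.exp_pos _).le, Real.log_exp]

section HasLaw

variable {Ω : Type*} [MeasurableSpace Ω] {μ : Measure Ω} {X : Ω → α}

lemma hasLaw_logDensity_comp {Φ : α → β}
    (hΦ : MeasurePreserving Φ Λ Λ') (hc : Measurable c)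
    (hX : HasLaw X (withLogDensity Λ fun x => c (Φ x)) μ) :
    HasLaw (fun ω => Φ (X ω)) (withLogDensity Λ' c) μ :=
  HasLaw.comp ⟨hΦ.measurable.aemeasurable, map_withLogDensity hΦ hc⟩ hX

variable [IsProbabilityMeasure (withLogDensity Λ b)]

lemma llr_map_withLogDensity (hX : HasLaw X (withLogDensity Λ a) μ) (ha : Measurable a)
    (hb : Measurable b) :
    (fun ω => llr (μ.map X) (withLogDensity Λ b) (X ω)) =ᵐ[μ] fun ω => a (X ω) - b (X ω) := by
  refine ae_of_ae_map hX.aemeasurable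
    (p := fun x => llr (μ.map X) (withLogDensity Λ b) x = a x - b x) ?_
  rw [hX.map_eq]
  exact llr_withLogDensity ha hb

lemma klDiv_map_withLogDensity_ne_top (hX : HasLaw X (withLogDensity Λ a) μ) (ha : Measurable a)
    (hb : Measurable b) (hia : Integrable (fun ω => a (X ω)) μ)
    (hib : Integrable (fun ω => b (X ω)) μ) : klDiv (μ.map X) (withLogDensity Λ b) ≠ ∞ := by
  rw [klDiv_ne_top_iff, integrable_map_measure (by fun_prop) hX.aemeasurable]
  refine ⟨?_, (integrable_congr (llr_map_withLogDensity hX ha hb)).2 (hia.sub hib)⟩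
  rw [hX.map_eq]
  exact withLogDensity_absolutelyContinuous ha hb

variable [IsProbabilityMeasure μ]

lemma toReal_klDiv_map_withLogDensity (hX : HasLaw X (withLogDensity Λ a) μ) (ha : Measurable a)
    (hb : Measurable b) (hia : Integrable (fun ω => a (X ω)) μ)
    (hib : Integrable (fun ω => b (X ω)) μ) :
    (klDiv (μ.map X) (withLogDensity Λ b)).toReal = ∫ ω, a (X ω) ∂μ - ∫ ω, b (X ω) ∂μ := by
  have := Measure.isProbabilityMeasure_map hX.aemeasurable
  rw [toReal_klDiv_of_measure_eq
      (klDiv_ne_top_iff.1 (klDiv_map_withLogDensity_ne_top hX ha hb hia hib)).1 (by simp),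
    integral_map hX.aemeasurable (by fun_prop), integral_congr_ae (llr_map_withLogDensity hX ha hb),
    integral_sub hia hib]

lemma klDiv_map_withLogDensity (hX : HasLaw X (withLogDensity Λ a) μ) (ha : Measurable a)
    (hb : Measurable b) (hia : Integrable (fun ω => a (X ω)) μ)
    (hib : Integrable (fun ω => b (X ω)) μ) :
    klDiv (μ.map X) (withLogDensity Λ b) =
      ENNReal.ofReal (∫ ω, a (X ω) ∂μ - ∫ ω, b (X ω) ∂μ) := by
  rw [← toReal_klDiv_map_withLogDensity hX ha hb hia hib,
    ENNReal.ofReal_toReal (klDiv_map_withLogDensity_ne_top hX ha hb hia hib)]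

lemma measureReal_preimage_mul_log_le (hX : HasLaw X (withLogDensity Λ a) μ) (ha : Measurable a)
    (hb : Measurable b) (hia : Integrable (fun ω => a (X ω)) μ)
    (hib : Integrable (fun ω => b (X ω)) μ) {D : Set α} (hD : MeasurableSet D) {N : ℕ} [NeZero N]
    (hN : withLogDensity Λ b D ≤ (N : ℝ≥0∞)⁻¹) :
    μ.real (X ⁻¹' D) * Real.log N ≤ ∫ ω, a (X ω) ∂μ - ∫ ω, b (X ω) ∂μ + 1 := by
  have := Measure.isProbabilityMeasure_map hX.aemeasurable
  have hguess : (N : ℝ) * (withLogDensity Λ b).real D ≤ 1 := by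
    have h := ENNReal.toReal_mono (by simp [NeZero.ne]) hN
    rw [ENNReal.toReal_inv, ENNReal.toReal_natCast] at h
    calc (N : ℝ) * (withLogDensity Λ b).real D ≤ N * (N : ℝ)⁻¹ := by gcongr; exact h
      _ = 1 := mul_inv_cancel₀ (NeZero.ne _)
  rw [← map_measureReal_apply_of_aemeasurable hX.aemeasurable hD,
    ← toReal_klDiv_map_withLogDensity hX ha hb hia hib]
  exact measureReal_mul_log_le_toReal_klDiv (klDiv_map_withLogDensity_ne_top hX ha hb hia hib) hD
    (Nat.one_le_cast.2 NeZero.one_le) hguess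

end HasLaw

end LogDensity

section CondLogDensity

variable {Ω α β γ : Type*} [MeasurableSpace Ω] [MeasurableSpace α] [MeasurableSpace β]
  [MeasurableSpace γ] {μ : Measure Ω}

/-- `exp (a (w, y))` is a conditional density of `Y` given `W = w` with respect to `Λ`. -/
def HasCondLogDensity (Y : Ω → β) (W : Ω → γ) (Λ : Measure β) (a : γ × β → ℝ)
    (μ : Measure Ω) : Prop :=
  HasLaw (fun ω => (W ω, Y ω)) (withLogDensity ((μ.map W).prod Λ) a) μ

variable {Λ : Measure β}

lemma HasCondLogDensity.hasLaw_prodMk {Θ : Measure α} [SFinite Λ] {W : Ω → α}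
    {Y : Ω → β} {ℓ : α → ℝ} {a : α × β → ℝ} (hY : HasCondLogDensity Y W Λ a μ)
    (hW : HasLaw W (withLogDensity Θ ℓ) μ) (hℓ : Measurable ℓ) (ha : Measurable a) :
    HasLaw (fun ω => (W ω, Y ω)) (withLogDensity (Θ.prod Λ) fun p => ℓ p.1 + a p) μ := by
  rwa [HasCondLogDensity, hW.map_eq, withLogDensity_prod hℓ,
    withLogDensity_withLogDensity (by fun_prop) ha] at hY

variable [IsProbabilityMeasure μ]

lemma mutualInfo_eq_of_logDensity [SFinite Λ] {X : Ω → α} {Y : Ω → β} {a : α × β → ℝ}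
    {b : β → ℝ} (hX : AEMeasurable X μ) (ha : Measurable a) (hb : Measurable b)
    (hXY : HasCondLogDensity Y X Λ a μ) (hY : HasLaw Y (withLogDensity Λ b) μ)
    (hia : Integrable (fun ω => a (X ω, Y ω)) μ) (hib : Integrable (fun ω => b (Y ω)) μ) :
    mutualInfo X Y μ = ENNReal.ofReal (∫ ω, a (X ω, Y ω) ∂μ - ∫ ω, b (Y ω) ∂μ) := by
  have := Measure.isProbabilityMeasure_map (μ := μ) hX
  have := hY.isProbabilityMeasure_iff.1 ‹_›
  have hprod := prod_withLogDensity (Λ := μ.map X) (Λ' := Λ) hb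
  have : IsProbabilityMeasure (withLogDensity ((μ.map X).prod Λ) fun p => b p.2) := by
    rw [← hprod]; infer_instance
  rw [mutualInfo, hY.map_eq, hprod]
  exact klDiv_map_withLogDensity hXY ha (by fun_prop) hia hib

variable [StandardBorelSpace α] [Nonempty α] [StandardBorelSpace β] [Nonempty β]

lemma map_compProd_condDistrib_prod [SFinite Λ] {X : Ω → α} {Y : Ω → β} {W : Ω → γ}
    {b : γ × β → ℝ} (hX : AEMeasurable X μ) (hY : AEMeasurable Y μ) (hb : Measurable b)
    (hWY : HasCondLogDensity Y W Λ b μ) :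
    (μ.map W ⊗ₘ (condDistrib X W μ ×ₖ condDistrib Y W μ)).map
        (fun p : γ × α × β => ((p.1, p.2.1), p.2.2)) =
      withLogDensity ((μ.map fun ω => (W ω, X ω)).prod Λ) fun p => b (p.1.1, p.2) := by
  refine Measure.ext_of_lintegral _ fun F hF => ?_
  let G : γ × β → ℝ≥0∞ := fun q => ∫⁻ x, F ((q.1, x), q.2) ∂(condDistrib X W μ q.1)
  have hG : Measurable G := by
    have h : Measurable fun q : (γ × β) × α => F ((q.1.1, q.2), q.1.2) := by fun_prop
    exact h.lintegral_kernel_prod_right' (κ := (condDistrib X W μ).comap Prod.fst measurable_fst)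
  have hleft : ∫⁻ p, F p ∂((μ.map W ⊗ₘ (condDistrib X W μ ×ₖ condDistrib Y W μ)).map
      fun p : γ × α × β => ((p.1, p.2.1), p.2.2)) = ∫⁻ q, G q ∂(μ.map fun ω => (W ω, Y ω)) := by
    rw [lintegral_map hF (by fun_prop), Measure.lintegral_compProd (by fun_prop),
      ← compProd_map_condDistrib hY, Measure.lintegral_compProd hG]
    refine lintegral_congr fun w => ?_
    rw [Kernel.prod_apply, lintegral_prod_symm' _ (by fun_prop)]
  rw [hleft, hWY.map_eq, lintegral_withLogDensity hb hG, lintegral_withLogDensity (by fun_prop) hF,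
    lintegral_prod _ (by fun_prop), lintegral_prod _ (by fun_prop),
    ← compProd_map_condDistrib hX, Measure.lintegral_compProd (by fun_prop)]
  refine lintegral_congr fun w => ?_
  rw [lintegral_lintegral_swap (by fun_prop)]
  refine lintegral_congr fun y => ?_
  exact (lintegral_const_mul _ (by fun_prop)).symm

lemma le_condMutualInfo_of_logDensity [SFinite Λ] {X : Ω → α} {Y : Ω → β} {W : Ω → γ}
    {a : (γ × α) × β → ℝ} {b : γ × β → ℝ} (hX : AEMeasurable X μ) (hY : AEMeasurable Y μ)
    (hW : AEMeasurable W μ) (ha : Measurable a) (hb : Measurable b)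
    (hWXY : HasCondLogDensity Y (fun ω => (W ω, X ω)) Λ a μ) (hWY : HasCondLogDensity Y W Λ b μ)
    (hia : Integrable (fun ω => a ((W ω, X ω), Y ω)) μ)
    (hib : Integrable (fun ω => b (W ω, Y ω)) μ) :
    ENNReal.ofReal (∫ ω, a ((W ω, X ω), Y ω) ∂μ - ∫ ω, b (W ω, Y ω) ∂μ) ≤
      condMutualInfo X Y W μ := by
  have := Measure.isProbabilityMeasure_map (μ := μ) hW
  have hassoc : Measurable fun p : γ × α × β => ((p.1, p.2.1), p.2.2) := by fun_prop
  have hR := map_compProd_condDistrib_prod hX hY hb hWY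
  have : IsProbabilityMeasure
      (withLogDensity ((μ.map fun ω => (W ω, X ω)).prod Λ) fun p => b (p.1.1, p.2)) := by
    rw [← hR]
    exact Measure.isProbabilityMeasure_map hassoc.aemeasurable
  refine le_trans ?_ (klDiv_map_le _ _ hassoc)
  rw [hR, AEMeasurable.map_map_of_aemeasurable hassoc.aemeasurable (by fun_prop)]
  exact (klDiv_map_withLogDensity hWXY ha (by fun_prop) hia hib).ge

end CondLogDensity

section AdditiveNoise

variable {Ω β γ E : Type*} [MeasurableSpace Ω] [MeasurableSpace β] [MeasurableSpace γ]
  [MeasurableSpace E] [AddCommGroup E] [MeasurableAdd₂ E] [MeasurableSub₂ E] {μ : Measure Ω}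
  {A : Measure γ} {Λ : Measure E} {f : γ → E} {ℓ : E → ℝ}

lemma map_add_prod_withLogDensity [SFinite A] [SFinite Λ] [Λ.IsAddLeftInvariant]
    (hf : Measurable f) (hℓ : Measurable ℓ) :
    (A.prod (withLogDensity Λ ℓ)).map (fun p => (p.1, f p.1 + p.2)) =
      withLogDensity (A.prod Λ) fun p => ℓ (p.2 - f p.1) := by
  have hshear : MeasurePreserving (fun p : γ × E => (p.1, f p.1 + p.2)) (A.prod Λ) (A.prod Λ) :=
    (MeasurePreserving.id A).skew_product (by fun_prop)
      (ae_of_all _ fun w => map_add_left_eq_self Λ (f w))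
  have hmap := map_withLogDensity hshear (c := fun p => ℓ (p.2 - f p.1)) (by fun_prop)
  simp only [Function.comp_def, add_sub_cancel_left] at hmap
  rw [prod_withLogDensity hℓ, hmap]

lemma map_add_withLogDensity_prod_withLogDensity [SFinite A] [SFinite Λ] [Λ.IsAddLeftInvariant]
    {r : γ → ℝ} (hr : Measurable r) (hf : Measurable f) (hℓ : Measurable ℓ) :
    ((withLogDensity A r).prod (withLogDensity Λ ℓ)).map (fun p => (p.1, f p.1 + p.2)) =
      withLogDensity (A.prod Λ) fun p => r p.1 + ℓ (p.2 - f p.1) := by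
  rw [map_add_prod_withLogDensity hf hℓ, withLogDensity_prod hr,
    withLogDensity_withLogDensity (by fun_prop) (by fun_prop)]

lemma isProbabilityMeasure_withLogDensity_sub [IsProbabilityMeasure A] [SFinite Λ]
    [Λ.IsAddLeftInvariant] [IsProbabilityMeasure (withLogDensity Λ ℓ)] (hf : Measurable f)
    (hℓ : Measurable ℓ) :
    IsProbabilityMeasure (withLogDensity (A.prod Λ) fun p => ℓ (p.2 - f p.1)) := by
  rw [← map_add_prod_withLogDensity hf hℓ]
  exact Measure.isProbabilityMeasure_map (by fun_prop)

lemma hasCondLogDensity_add_of_indepFun [IsProbabilityMeasure μ] [SFinite Λ]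
    [Λ.IsAddLeftInvariant] {W : Ω → γ} {V : Ω → E} (hW : AEMeasurable W μ) (hWV : W ⟂ᵢ[μ] V)
    (hV : HasLaw V (withLogDensity Λ ℓ) μ) (hf : Measurable f) (hℓ : Measurable ℓ) :
    HasCondLogDensity (fun ω => f (W ω) + V ω) W Λ (fun p => ℓ (p.2 - f p.1)) μ := by
  have hVm := hV.aemeasurable
  refine ⟨by fun_prop, ?_⟩
  rw [← map_add_prod_withLogDensity hf hℓ, ← hV.map_eq, ← (indepFun_iff_map_prod_eq_prod_map_map
    hW hVm).1 hWV, AEMeasurable.map_map_of_aemeasurable (by fun_prop) (by fun_prop)]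
  rfl

end AdditiveNoise

section Posterior

variable {ι α E F : Type*} [MeasurableSpace ι] [MeasurableSpace α] [MeasurableSpace E]
  [MeasurableSpace F] [AddCommGroup F] [MeasurableAdd₂ F] [MeasurableSub₂ F] {π : Measure ι}
  [SFinite π] {Λ : Measure E} [SFinite Λ] {Λ' : Measure F} [SFinite Λ'] [Λ'.IsAddLeftInvariant]
  {r : E → ℝ} {ℓ : F → ℝ} {h : ι × E → F}

lemma prod_setOf_guess_le [MeasurableEq ι] {ρ : Measure α}
    [IsProbabilityMeasure ρ] {c : ℝ≥0∞} (hπ : ∀ m, π {m} ≤ c) {d : α → ι} (hd : Measurable d) :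
    (π.prod ρ) {p | d p.2 = p.1} ≤ c := by
  rw [Measure.prod_apply_symm (measurableSet_eq_fun (by fun_prop) (by fun_prop))]
  calc ∫⁻ y, π {m | d y = m} ∂ρ ≤ ∫⁻ _, c ∂ρ := lintegral_mono fun y => by
        simpa only [Set.ofPred_eq_eq_singleton'] using hπ (d y)
    _ = c := by simp

lemma map_add_prod_withLogDensity_prod_withLogDensity (hr : Measurable r) (hh : Measurable h)
    (hℓ : Measurable ℓ) :
    ((π.prod (withLogDensity Λ r)).prod (withLogDensity Λ' ℓ)).map (fun p => (p.1, h p.1 + p.2)) =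
      withLogDensity ((π.prod Λ).prod Λ') fun p => r p.1.2 + ℓ (p.2 - h p.1) := by
  have hr' : Measurable fun p : ι × E => r p.2 := by fun_prop
  rw [prod_withLogDensity hr, map_add_withLogDensity_prod_withLogDensity hr' hh hℓ]

variable [IsProbabilityMeasure (withLogDensity Λ r)] [IsProbabilityMeasure (withLogDensity Λ' ℓ)]

lemma isProbabilityMeasure_withLogDensity_posterior [IsProbabilityMeasure π] (hr : Measurable r)
    (hh : Measurable h) (hℓ : Measurable ℓ) : IsProbabilityMeasure
      (withLogDensity ((π.prod Λ).prod Λ') fun p => r p.1.2 + ℓ (p.2 - h p.1)) := by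
  rw [← map_add_prod_withLogDensity_prod_withLogDensity hr hh hℓ]
  exact Measure.isProbabilityMeasure_map (by fun_prop)

lemma withLogDensity_posterior_setOf_guess_le [MeasurableEq ι]
    {c : ℝ≥0∞} (hπ : ∀ m, π {m} ≤ c) (hr : Measurable r) (hh : Measurable h) (hℓ : Measurable ℓ)
    {d : E → ι} (hd : Measurable d) :
    withLogDensity ((π.prod Λ).prod Λ') (fun p => r p.1.2 + ℓ (p.2 - h p.1))
      {p | d p.1.2 = p.1.1} ≤ c := by
  have hG : MeasurableSet {p : ι × E | d p.2 = p.1} :=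
    measurableSet_eq_fun (by fun_prop) (by fun_prop)
  have hG' : MeasurableSet {p : (ι × E) × F | d p.1.2 = p.1.1} := measurable_fst hG
  rw [← map_add_prod_withLogDensity_prod_withLogDensity hr hh hℓ,
    Measure.map_apply (by fun_prop) hG']
  exact (measurePreserving_fst.measure_preimage hG.nullMeasurableSet).trans_le
    (prod_setOf_guess_le hπ hd)

end Posterior

section Converse

variable {Ω ι α β E F : Type*} [MeasurableSpace Ω] [MeasurableSpace ι] [MeasurableSpace α]
  [MeasurableSpace β] {μ : Measure Ω} [IsProbabilityMeasure μ]

lemma measurePreserving_prod_right_comm [MeasurableSpace E] {A : Measure α} {B : Measure β}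
    {C : Measure E} [SFinite A] [SFinite B] [SFinite C] :
    MeasurePreserving (fun p : (α × β) × E => ((p.1.1, p.2), p.1.2))
      ((A.prod B).prod C) ((A.prod C).prod B) :=
  ((measurePreserving_prodAssoc A C B).symm _).comp
    (((MeasurePreserving.id A).prod Measure.measurePreserving_swap).comp
      (measurePreserving_prodAssoc A B C))

variable [MeasurableEq ι] [MeasurableSpace E] {Λ : Measure E}
  [SFinite Λ] {M : Ω → ι} {Y : Ω → E} {N : ℕ} [NeZero N]

/- The reference law draws `Y` independently of `M` and then `T` from `Y` and `M`, so that `M` is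
guessed blindly from `Y` although `T` depends on both. -/
lemma correct_mul_log_le_of_posterior [MeasurableSpace F] [AddCommGroup F]
    [MeasurableAdd₂ F] [MeasurableSub₂ F] {Λ' : Measure F} [SFinite Λ'] [Λ'.IsAddLeftInvariant]
    {T : Ω → F} (hM : AEMeasurable M μ) (hMT : M ⟂ᵢ[μ] T) (hMN : ∀ m, μ.map M {m} ≤ (N : ℝ≥0∞)⁻¹)
    {ℓ ℓ' : F → ℝ} (hℓ : Measurable ℓ) (hT : HasLaw T (withLogDensity Λ' ℓ) μ)
    {a : (ι × F) × E → ℝ} (ha : Measurable a)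
    (hY : HasCondLogDensity Y (fun ω => (M ω, T ω)) Λ a μ)
    {r : E → ℝ} (hr : Measurable r) [IsProbabilityMeasure (withLogDensity Λ r)]
    (hℓ' : Measurable ℓ') [IsProbabilityMeasure (withLogDensity Λ' ℓ')]
    {h : ι × E → F} (hh : Measurable h)
    (hiℓ : Integrable (fun ω => ℓ (T ω)) μ) (hia : Integrable (fun ω => a ((M ω, T ω), Y ω)) μ)
    (hir : Integrable (fun ω => r (Y ω)) μ)
    (hiℓ' : Integrable (fun ω => ℓ' (T ω - h (M ω, Y ω))) μ) {d : E → ι} (hd : Measurable d) :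
    μ.real {ω | d (Y ω) = M ω} * Real.log N ≤
      (∫ ω, ℓ (T ω) ∂μ + ∫ ω, a ((M ω, T ω), Y ω) ∂μ) -
        (∫ ω, r (Y ω) ∂μ + ∫ ω, ℓ' (T ω - h (M ω, Y ω)) ∂μ) + 1 := by
  have := Measure.isProbabilityMeasure_map hM
  have hc : Measurable fun p : (ι × E) × F => ℓ p.2 + a ((p.1.1, p.2), p.1.2) := by fun_prop
  have hb : Measurable fun p : (ι × E) × F => r p.1.2 + ℓ' (p.2 - h p.1) := by fun_prop
  have hℓ₂ : Measurable fun p : ι × F => ℓ p.2 := by fun_prop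
  have hMT' : HasLaw (fun ω => (M ω, T ω)) (withLogDensity ((μ.map M).prod Λ') fun p => ℓ p.2) μ :=
    ⟨hM.prodMk hT.aemeasurable, by
      rw [(indepFun_iff_map_prod_eq_prod_map_map hM hT.aemeasurable).1 hMT, hT.map_eq,
        prod_withLogDensity hℓ]⟩
  have hMTY := hY.hasLaw_prodMk hMT' hℓ₂ ha
  have hlaw : HasLaw (fun ω => ((M ω, Y ω), T ω)) (withLogDensity (((μ.map M).prod Λ).prod Λ')
      fun p => ℓ p.2 + a ((p.1.1, p.2), p.1.2)) μ :=
    hasLaw_logDensity_comp measurePreserving_prod_right_comm hc hMTY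
  have := isProbabilityMeasure_withLogDensity_posterior (π := μ.map M) (Λ := Λ) (Λ' := Λ')
    hr hh hℓ'
  have hguess := withLogDensity_posterior_setOf_guess_le (Λ := Λ) (Λ' := Λ') hMN hr hh hℓ' hd
  have hD : MeasurableSet {p : (ι × E) × F | d p.1.2 = p.1.1} :=
    measurableSet_eq_fun (by fun_prop) (by fun_prop)
  have hic : Integrable (fun ω => ℓ (T ω) + a ((M ω, T ω), Y ω)) μ := hiℓ.add hia
  have hib : Integrable (fun ω => r (Y ω) + ℓ' (T ω - h (M ω, Y ω))) μ := hir.add hiℓ'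
  rw [← integral_add hiℓ hia, ← integral_add hir hiℓ']
  exact measureReal_preimage_mul_log_le hlaw hc hb hic hib hD hguess

variable [AddCommGroup E] [MeasurableAdd₂ E] [MeasurableSub₂ E] [Λ.IsAddLeftInvariant]

/- The reference law keeps `B` but replaces the conditional law of `Y` by one that ignores `M`, so
that `M` can only be guessed blindly. -/
lemma correct_mul_log_le_of_sideInfo {B : Ω → β} (hM : AEMeasurable M μ) (hB : AEMeasurable B μ)
    (hMB : M ⟂ᵢ[μ] B) (hMN : ∀ m, μ.map M {m} ≤ (N : ℝ≥0∞)⁻¹) {a : (ι × β) × E → ℝ}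
    (ha : Measurable a) (hY : HasCondLogDensity Y (fun ω => (M ω, B ω)) Λ a μ)
    {g : β → E} (hg : Measurable g) {ℓ : E → ℝ} (hℓ : Measurable ℓ)
    [IsProbabilityMeasure (withLogDensity Λ ℓ)]
    (hia : Integrable (fun ω => a ((M ω, B ω), Y ω)) μ)
    (hiℓ : Integrable (fun ω => ℓ (Y ω - g (B ω))) μ) {d : β × E → ι} (hd : Measurable d) :
    μ.real {ω | d (B ω, Y ω) = M ω} * Real.log N ≤
      ∫ ω, a ((M ω, B ω), Y ω) ∂μ - ∫ ω, ℓ (Y ω - g (B ω)) ∂μ + 1 := by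
  have := Measure.isProbabilityMeasure_map hM
  have := Measure.isProbabilityMeasure_map hB
  have hc : Measurable fun q : ι × β × E => a ((q.1, q.2.1), q.2.2) := by fun_prop
  have hr : Measurable fun p : β × E => ℓ (p.2 - g p.1) := by fun_prop
  have hr' : Measurable fun q : ι × β × E => ℓ (q.2.2 - g q.2.1) := by fun_prop
  have hlaw : HasLaw (fun ω => (M ω, B ω, Y ω))
      (withLogDensity ((μ.map M).prod ((μ.map B).prod Λ)) fun q => a ((q.1, q.2.1), q.2.2)) μ := by
    have h := hY
    rw [HasCondLogDensity, (indepFun_iff_map_prod_eq_prod_map_map hM hB).1 hMB] at h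
    exact hasLaw_logDensity_comp (measurePreserving_prodAssoc _ _ _) hc h
  have : IsProbabilityMeasure (withLogDensity ((μ.map B).prod Λ) fun p => ℓ (p.2 - g p.1)) :=
    isProbabilityMeasure_withLogDensity_sub hg hℓ
  have hprod := prod_withLogDensity (Λ := μ.map M) (Λ' := (μ.map B).prod Λ) hr
  have : IsProbabilityMeasure (withLogDensity ((μ.map M).prod ((μ.map B).prod Λ))
      fun q => ℓ (q.2.2 - g q.2.1)) := by
    rw [← hprod]; infer_instance
  have hguess : withLogDensity ((μ.map M).prod ((μ.map B).prod Λ))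
      (fun q => ℓ (q.2.2 - g q.2.1)) {q | d q.2 = q.1} ≤ (N : ℝ≥0∞)⁻¹ := by
    rw [← hprod]
    exact prod_setOf_guess_le hMN hd
  have hD : MeasurableSet {q : ι × β × E | d q.2 = q.1} :=
    measurableSet_eq_fun (by fun_prop) (by fun_prop)
  exact measureReal_preimage_mul_log_le hlaw hc hr' hia hiℓ hD hguess

end Converse

section Energy

variable {Ω ι : Type*} [MeasurableSpace Ω] [Fintype ι] {X Y : Ω → ι → ℝ} {μ : Measure Ω}

/-- The sum over the coordinates of the expected products `E[Xᵢ Yᵢ]`. -/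
def correlation (X Y : Ω → ι → ℝ) (μ : Measure Ω) : ℝ := ∑ i, ∫ ω, X ω i * Y ω i ∂μ

/-- The energy `∑ᵢ E[Xᵢ²]` of a random vector, which the power constraints bound. -/
def energy (X : Ω → ι → ℝ) (μ : Measure Ω) : ℝ := ∑ i, ∫ ω, X ω i ^ 2 ∂μ

lemma energy_nonneg : 0 ≤ energy X μ :=
  Finset.sum_nonneg fun _ _ => integral_nonneg fun _ => sq_nonneg _

lemma energy_smul_add_smul (hX : MemLp X 2 μ) (hY : MemLp Y 2 μ) (α β : ℝ) :
    energy (fun ω => α • X ω + β • Y ω) μ =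
      α ^ 2 * energy X μ + 2 * α * β * correlation X Y μ + β ^ 2 * energy Y μ := by
  simp only [energy, correlation, Finset.mul_sum, ← Finset.sum_add_distrib]
  refine Finset.sum_congr rfl fun i _ => ?_
  have hXX := (hX.eval i).integrable_sq.const_mul (α ^ 2)
  have hYY := (hY.eval i).integrable_sq.const_mul (β ^ 2)
  have hXY := ((hX.eval i).integrable_mul (hY.eval i)).const_mul (2 * α * β)
  simp only [Pi.mul_apply] at hXY
  have hsum : Integrable (fun ω => α ^ 2 * X ω i ^ 2 + 2 * α * β * (X ω i * Y ω i)) μ :=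
    hXX.add hXY
  rw [← integral_const_mul, ← integral_const_mul, ← integral_const_mul, ← integral_add hXX hXY,
    ← integral_add hsum hYY]
  refine integral_congr_ae (ae_of_all _ fun ω => ?_)
  simp only [Pi.add_apply, Pi.smul_apply, smul_eq_mul]
  ring

lemma correlation_eq_zero_of_indepFun (hX : MemLp X 2 μ) (hY : MemLp Y 2 μ) (hXY : X ⟂ᵢ[μ] Y)
    (hY0 : ∀ i, ∫ ω, Y ω i ∂μ = 0) : correlation X Y μ = 0 := by
  refine Finset.sum_eq_zero fun i _ => ?_
  have hi : (fun ω => X ω i) ⟂ᵢ[μ] fun ω => Y ω i :=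
    hXY.comp (measurable_pi_apply i) (measurable_pi_apply i)
  rw [hi.integral_fun_mul_eq_mul_integral (hX.eval i).aestronglyMeasurable
    (hY.eval i).aestronglyMeasurable, hY0 i, mul_zero]

lemma energy_add_smul_of_indepFun (hX : MemLp X 2 μ) (hY : MemLp Y 2 μ) (hXY : X ⟂ᵢ[μ] Y)
    (hY0 : ∀ i, ∫ ω, Y ω i ∂μ = 0) (c : ℝ) :
    energy (fun ω => X ω + c • Y ω) μ = energy X μ + c ^ 2 * energy Y μ := by
  have h := energy_smul_add_smul hX hY 1 c
  rw [correlation_eq_zero_of_indepFun hX hY hXY hY0] at h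
  simpa using h

lemma energy_sub_integral_le [IsProbabilityMeasure μ] (hX : MemLp X 2 μ) :
    energy (fun ω i => X ω i - ∫ ω', X ω' i ∂μ) μ ≤ energy X μ := by
  refine Finset.sum_le_sum fun i _ => ?_
  have hXi := (hX.eval i).aestronglyMeasurable
  rw [← variance_eq_integral hXi.aemeasurable]
  exact variance_le_expectation_sq hXi

end Energy

section GaussianDensity

/-- The logarithm of the density of `N(0, v)`. -/
def gaussLogPDF (v x : ℝ) : ℝ := -(Real.log (2 * Real.pi * v) / 2) - x ^ 2 / (2 * v)

/-- The logarithm of the density of `n` independent `N(0, v)` variables. -/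
def gaussVecLogPDF {n : ℕ} (v : ℝ) (u : Fin n → ℝ) : ℝ := ∑ i, gaussLogPDF v (u i)

@[fun_prop]
lemma measurable_gaussLogPDF (v : ℝ) : Measurable (gaussLogPDF v) := by
  unfold gaussLogPDF
  fun_prop

@[fun_prop]
lemma measurable_gaussVecLogPDF {n : ℕ} (v : ℝ) :
    Measurable (gaussVecLogPDF v : (Fin n → ℝ) → ℝ) := by
  unfold gaussVecLogPDF
  fun_prop

lemma gaussianReal_eq_withLogDensity {v : ℝ≥0} (hv : v ≠ 0) :
    gaussianReal 0 v = withLogDensity volume (gaussLogPDF v) := by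
  have hpos : 0 < 2 * Real.pi * v := by positivity
  rw [gaussianReal_of_var_ne_zero _ hv, withLogDensity]
  congr 1 with x
  rw [gaussianPDF, gaussianPDFReal, gaussLogPDF, sub_eq_add_neg (-_), Real.exp_add, Real.exp_neg,
    Real.sqrt_eq_rpow, Real.rpow_def_of_pos hpos, neg_div, sub_zero]
  congr 4
  ring

lemma lintegral_pi_prod {α : Type*} [MeasurableSpace α] {n : ℕ} {Λ : Fin n → Measure α}
    [∀ i, SigmaFinite (Λ i)] {f : Fin n → α → ℝ≥0∞} (hf : ∀ i, Measurable (f i)) :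
    ∫⁻ x, ∏ i, f i (x i) ∂(Measure.pi Λ) = ∏ i, ∫⁻ x, f i x ∂(Λ i) := by
  induction n with
  | zero => simp
  | succ n ih =>
    rw [← ((measurePreserving_piFinSuccAbove Λ 0).symm).lintegral_comp (by fun_prop)]
    simp_rw [MeasurableEquiv.piFinSuccAbove_symm_apply, Fin.insertNthEquiv,
      Fin.prod_univ_succ, Fin.insertNth_zero, Equiv.coe_fn_mk, Fin.cons_succ,
      Fin.zero_succAbove, Fin.cons_zero]
    have htail : Measurable fun x : Fin n → α => ∏ i, f i.succ (x i) :=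
      Finset.measurable_fun_prod _ fun i _ => (hf i.succ).comp (measurable_pi_apply i)
    rw [← ih fun i => hf i.succ, ← lintegral_prod_mul (hf 0).aemeasurable htail.aemeasurable]
    rfl

lemma pi_withLogDensity {α : Type*} [MeasurableSpace α] {n : ℕ} {Λ : Fin n → Measure α}
    [∀ i, SigmaFinite (Λ i)] {a : Fin n → α → ℝ} [∀ i, SigmaFinite (withLogDensity (Λ i) (a i))]
    (ha : ∀ i, Measurable (a i)) :
    Measure.pi (fun i => withLogDensity (Λ i) (a i)) =
      withLogDensity (Measure.pi Λ) fun u => ∑ i, a i (u i) := by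
  refine Measure.pi_eq fun s hs => ?_
  rw [withLogDensity, withDensity_apply _ (MeasurableSet.univ_pi hs), Measure.restrict_pi_pi]
  simp_rw [Real.exp_sum, ENNReal.ofReal_prod_of_nonneg fun _ _ => (Real.exp_pos _).le]
  rw [lintegral_pi_prod fun i => (ha i).exp.ennreal_ofReal]
  exact Finset.prod_congr rfl fun i _ => (withDensity_apply _ (hs i)).symm

lemma pi_gaussianReal_eq_withLogDensity (n : ℕ) {v : ℝ≥0} (hv : v ≠ 0) :
    (Measure.pi fun _ : Fin n => gaussianReal 0 v) = withLogDensity volume (gaussVecLogPDF v) := by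
  have : SigmaFinite (withLogDensity volume (gaussLogPDF v)) := by
    rw [← gaussianReal_eq_withLogDensity hv]; infer_instance
  simp_rw [gaussianReal_eq_withLogDensity hv]
  exact pi_withLogDensity fun _ => measurable_gaussLogPDF _

lemma isProbabilityMeasure_withLogDensity_gaussVecLogPDF (n : ℕ) {v : ℝ} (hv : 0 < v) :
    IsProbabilityMeasure (withLogDensity volume (gaussVecLogPDF (n := n) v)) := by
  lift v to ℝ≥0 using hv.le
  rw [← pi_gaussianReal_eq_withLogDensity n (by exact_mod_cast hv.ne')]
  infer_instance

variable {Ω : Type*} [MeasurableSpace Ω] {μ : Measure Ω}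

lemma integrable_gaussLogPDF [IsFiniteMeasure μ] {X : Ω → ℝ} (hX : MemLp X 2 μ) (v : ℝ) :
    Integrable (fun ω => gaussLogPDF v (X ω)) μ :=
  (integrable_const _).sub (hX.integrable_sq.div_const _)

lemma integral_gaussLogPDF [IsProbabilityMeasure μ] {X : Ω → ℝ} (hX : MemLp X 2 μ) (v : ℝ) :
    ∫ ω, gaussLogPDF v (X ω) ∂μ =
      -(Real.log (2 * Real.pi * v) / 2) - (∫ ω, X ω ^ 2 ∂μ) / (2 * v) := by
  unfold gaussLogPDF
  rw [integral_sub (integrable_const _) (hX.integrable_sq.div_const _), integral_const,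
    integral_div, probReal_univ, one_smul]

variable {n : ℕ} {X Z : Ω → Fin n → ℝ}

lemma integrable_gaussVecLogPDF [IsFiniteMeasure μ] (hX : MemLp X 2 μ) (v : ℝ) :
    Integrable (fun ω => gaussVecLogPDF v (X ω)) μ :=
  integrable_finsetSum _ fun i _ => integrable_gaussLogPDF (hX.eval i) v

lemma integral_gaussVecLogPDF [IsProbabilityMeasure μ] (hX : MemLp X 2 μ) (v : ℝ) :
    ∫ ω, gaussVecLogPDF v (X ω) ∂μ =
      -(n / 2 * Real.log (2 * Real.pi * v)) - energy X μ / (2 * v) := by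
  simp_rw [gaussVecLogPDF, energy, Finset.sum_div]
  rw [integral_finsetSum _ fun i _ => integrable_gaussLogPDF (hX.eval i) v]
  simp_rw [integral_gaussLogPDF (hX.eval _)]
  rw [Finset.sum_sub_distrib, Finset.sum_const, Finset.card_univ, Fintype.card_fin, nsmul_eq_mul]
  ring

lemma neg_integral_gaussVecLogPDF_le [IsProbabilityMeasure μ] (hX : MemLp X 2 μ) {v : ℝ}
    (hv : 0 < v) (h : energy X μ ≤ n * v) :
    -∫ ω, gaussVecLogPDF v (X ω) ∂μ ≤
      n / 2 * Real.log v + n / 2 * (Real.log (2 * Real.pi) + 1) := by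
  have hdiv : energy X μ / (2 * v) ≤ n / 2 := by
    rw [div_le_iff₀ (by positivity)]
    linarith
  rw [integral_gaussVecLogPDF hX, Real.log_mul (by positivity) hv.ne']
  linarith

lemma integral_sq_gaussianReal (v : ℝ≥0) : ∫ x, x ^ 2 ∂(gaussianReal 0 v) = v := by
  have h := variance_of_integral_eq_zero (μ := gaussianReal 0 v) (X := id)
    aemeasurable_id (by simp)
  rw [variance_id_gaussianReal] at h
  simpa using h.symm

lemma hasLaw_eval_of_pi {α : Type*} [MeasurableSpace α] {V : Ω → Fin n → α} {ρ : Fin n → Measure α}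
    [∀ i, IsProbabilityMeasure (ρ i)] (hV : HasLaw V (Measure.pi ρ) μ) (i : Fin n) :
    HasLaw (fun ω => V ω i) (ρ i) μ :=
  (measurePreserving_eval ρ i).hasLaw.fun_comp hV

variable {v : ℝ≥0}

lemma memLp_two_of_hasLaw_gaussianReal {V : Ω → ℝ} (hV : HasLaw V (gaussianReal 0 v) μ) :
    MemLp V 2 μ := by
  have h : MemLp id 2 (μ.map V) := hV.map_eq ▸ memLp_id_gaussianReal' 2 (by simp)
  exact h.comp_of_map hV.aemeasurable

lemma integral_sq_of_hasLaw_gaussianReal {V : Ω → ℝ} (hV : HasLaw V (gaussianReal 0 v) μ) :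
    ∫ ω, V ω ^ 2 ∂μ = v :=
  (hV.integral_comp (f := fun x => x ^ 2) (by fun_prop)).trans (integral_sq_gaussianReal v)

lemma memLp_two_of_hasLaw_pi_gaussianReal
    (hZ : HasLaw Z (Measure.pi fun _ => gaussianReal 0 v) μ) : MemLp Z 2 μ :=
  MemLp.of_eval fun i => memLp_two_of_hasLaw_gaussianReal (hasLaw_eval_of_pi hZ i)

lemma integral_eval_of_hasLaw_pi_gaussianReal
    (hZ : HasLaw Z (Measure.pi fun _ => gaussianReal 0 v) μ) (i : Fin n) :
    ∫ ω, Z ω i ∂μ = 0 := by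
  simpa using (hasLaw_eval_of_pi hZ i).integral_eq

lemma energy_of_hasLaw_pi_gaussianReal
    (hZ : HasLaw Z (Measure.pi fun _ => gaussianReal 0 v) μ) : energy Z μ = n * v := by
  simp_rw [energy, integral_sq_of_hasLaw_gaussianReal (hasLaw_eval_of_pi hZ _)]
  simp

lemma integral_gaussVecLogPDF_of_hasLaw [IsProbabilityMeasure μ]
    (hZ : HasLaw Z (Measure.pi fun _ => gaussianReal 0 1) μ) :
    ∫ ω, gaussVecLogPDF 1 (Z ω) ∂μ = -(n / 2 * (Real.log (2 * Real.pi) + 1)) := by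
  rw [integral_gaussVecLogPDF (memLp_two_of_hasLaw_pi_gaussianReal hZ),
    energy_of_hasLaw_pi_gaussianReal hZ, NNReal.coe_one]
  ring_nf

end GaussianDensity

section GaussianConverse

variable {Ω ι β : Type*} [MeasurableSpace Ω] [MeasurableSpace ι] [MeasurableSpace β]
  {μ : Measure Ω} {M : Ω → ι} {N n : ℕ} {T U Z : Ω → Fin n → ℝ}

lemma energy_add_smul_noise (hU : MemLp U 2 μ)
    (hZ : HasLaw Z (Measure.pi fun _ => gaussianReal 0 1) μ) (hUZ : U ⟂ᵢ[μ] Z) (c : ℝ) :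
    energy (fun ω => U ω + c • Z ω) μ = energy U μ + c ^ 2 * n := by
  rw [energy_add_smul_of_indepFun hU (memLp_two_of_hasLaw_pi_gaussianReal hZ) hUZ
    (integral_eval_of_hasLaw_pi_gaussianReal hZ), energy_of_hasLaw_pi_gaussianReal hZ,
    NNReal.coe_one, mul_one]

lemma memLp_add_smul_noise (hU : MemLp U 2 μ)
    (hZ : HasLaw Z (Measure.pi fun _ => gaussianReal 0 1) μ) (c : ℝ) :
    MemLp (fun ω => U ω + c • Z ω) 2 μ :=
  hU.add ((memLp_two_of_hasLaw_pi_gaussianReal hZ).const_smul c)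

variable [IsProbabilityMeasure μ]

lemma neg_integral_gaussVecLogPDF_add_smul_noise_le (hU : MemLp U 2 μ)
    (hZ : HasLaw Z (Measure.pi fun _ => gaussianReal 0 1) μ) (hUZ : U ⟂ᵢ[μ] Z) {c v : ℝ}
    (hv : 0 < v) (h : energy U μ + c ^ 2 * n ≤ n * v) :
    -∫ ω, gaussVecLogPDF v (U ω + c • Z ω) ∂μ ≤
      n / 2 * Real.log v + n / 2 * (Real.log (2 * Real.pi) + 1) :=
  neg_integral_gaussVecLogPDF_le (memLp_add_smul_noise hU hZ c) hv
    ((energy_add_smul_noise hU hZ hUZ c).trans_le h)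

variable [MeasurableEq ι] [NeZero N]

lemma correct_mul_log_le_of_gaussian_sideInfo {B : Ω → β} (hM : AEMeasurable M μ)
    (hB : AEMeasurable B μ) (hMB : M ⟂ᵢ[μ] B) (hMN : ∀ m, μ.map M {m} ≤ (N : ℝ≥0∞)⁻¹)
    (hZ : HasLaw Z (Measure.pi fun _ => gaussianReal 0 1) μ)
    (hMBZ : (fun ω => (M ω, B ω)) ⟂ᵢ[μ] Z) {f : ι × β → Fin n → ℝ} (hf : Measurable f)
    {g : β → Fin n → ℝ} (hg : Measurable g) (hU : MemLp (fun ω => f (M ω, B ω) - g (B ω)) 2 μ)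
    {D : ℝ} (hD : 0 < D) (hUD : energy (fun ω => f (M ω, B ω) - g (B ω)) μ + n ≤ n * D)
    {d : β × (Fin n → ℝ) → ι} (hd : Measurable d) :
    μ.real {ω | d (B ω, f (M ω, B ω) + Z ω) = M ω} * Real.log N ≤ n / 2 * Real.log D + 1 := by
  have := isProbabilityMeasure_withLogDensity_gaussVecLogPDF n hD
  have hZ2 := memLp_two_of_hasLaw_pi_gaussianReal hZ
  have hZ' := hZ
  rw [pi_gaussianReal_eq_withLogDensity n one_ne_zero, NNReal.coe_one] at hZ'
  have hY := hasCondLogDensity_add_of_indepFun (hM.prodMk hB) hMBZ hZ' hf (by fun_prop)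
  have hresid : ∀ ω, f (M ω, B ω) + Z ω - g (B ω) = f (M ω, B ω) - g (B ω) + (1 : ℝ) • Z ω :=
    fun ω => by rw [one_smul]; abel
  have hUZ : (fun ω => f (M ω, B ω) - g (B ω)) ⟂ᵢ[μ] Z :=
    hMBZ.comp (φ := fun p => f p - g p.2) (by fun_prop) measurable_id
  have hiU := integrable_gaussVecLogPDF (memLp_add_smul_noise hU hZ 1) D
  have key := correct_mul_log_le_of_sideInfo (g := g) (ℓ := gaussVecLogPDF D) hM hB hMB hMN
    (by fun_prop) hY hg (by fun_prop)
    (by simpa only [add_sub_cancel_left] using integrable_gaussVecLogPDF hZ2 1)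
    (by simpa only [hresid] using hiU) hd
  simp only [add_sub_cancel_left, hresid] at key
  have hent := neg_integral_gaussVecLogPDF_add_smul_noise_le (c := 1) hU hZ hUZ hD (by linarith)
  rw [integral_gaussVecLogPDF_of_hasLaw hZ] at key
  linarith

lemma correct_mul_log_le_of_gaussian_posterior (hM : AEMeasurable M μ) (hMT : M ⟂ᵢ[μ] T)
    (hMN : ∀ m, μ.map M {m} ≤ (N : ℝ≥0∞)⁻¹)
    (hT : HasLaw T (Measure.pi fun _ => gaussianReal 0 1) μ)
    (hZ : HasLaw Z (Measure.pi fun _ => gaussianReal 0 1) μ)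
    (hMTZ : (fun ω => (M ω, T ω)) ⟂ᵢ[μ] Z) {f : ι × (Fin n → ℝ) → Fin n → ℝ} (hf : Measurable f)
    (hX : MemLp (fun ω => f (M ω, T ω)) 2 μ) {g : ι → Fin n → ℝ} (hg : Measurable g)
    (hg2 : MemLp (fun ω => g (M ω)) 2 μ) {w q b : ℝ} (hw : 0 < w) (hq : 0 < q)
    (hXw : energy (fun ω => f (M ω, T ω)) μ + n ≤ n * w)
    (hTq : energy (fun ω => T ω - b • (f (M ω, T ω) - g (M ω))) μ + b ^ 2 * n ≤ n * q)
    {d : (Fin n → ℝ) → ι} (hd : Measurable d) :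
    μ.real {ω | d (f (M ω, T ω) + Z ω) = M ω} * Real.log N ≤
      n / 2 * (Real.log w + Real.log q) + 1 := by
  have := isProbabilityMeasure_withLogDensity_gaussVecLogPDF n hw
  have := isProbabilityMeasure_withLogDensity_gaussVecLogPDF n hq
  have hT2 := memLp_two_of_hasLaw_pi_gaussianReal hT
  have hZ2 := memLp_two_of_hasLaw_pi_gaussianReal hZ
  have hT' := hT
  have hZ' := hZ
  rw [pi_gaussianReal_eq_withLogDensity n one_ne_zero, NNReal.coe_one] at hT' hZ'
  have hY := hasCondLogDensity_add_of_indepFun (hM.prodMk hT.aemeasurable) hMTZ hZ' hf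
    (by fun_prop)
  have hR2 : MemLp (fun ω => T ω - b • (f (M ω, T ω) - g (M ω))) 2 μ :=
    hT2.sub ((hX.sub hg2).const_smul b)
  have hobs : ∀ ω, f (M ω, T ω) + Z ω = f (M ω, T ω) + (1 : ℝ) • Z ω := fun ω => by rw [one_smul]
  have hresid : ∀ ω, T ω - b • (f (M ω, T ω) + Z ω - g (M ω)) =
      T ω - b • (f (M ω, T ω) - g (M ω)) + -b • Z ω := fun ω => by
    simp only [smul_add, smul_sub, neg_smul]; abel
  have hXZ : (fun ω => f (M ω, T ω)) ⟂ᵢ[μ] Z := hMTZ.comp hf measurable_id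
  have hRZ : (fun ω => T ω - b • (f (M ω, T ω) - g (M ω))) ⟂ᵢ[μ] Z :=
    hMTZ.comp (φ := fun p => p.2 - b • (f p - g p.1)) (by fun_prop) measurable_id
  have hiY := integrable_gaussVecLogPDF (memLp_add_smul_noise hX hZ 1) w
  have hiR := integrable_gaussVecLogPDF (memLp_add_smul_noise hR2 hZ (-b)) q
  have key := correct_mul_log_le_of_posterior (r := gaussVecLogPDF w) (ℓ' := gaussVecLogPDF q)
    (h := fun p => b • (p.2 - g p.1)) hM hMT hMN (by fun_prop) hT' (by fun_prop) hY (by fun_prop)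
    (by fun_prop) (by fun_prop) (integrable_gaussVecLogPDF hT2 1)
    (by simpa only [add_sub_cancel_left] using integrable_gaussVecLogPDF hZ2 1)
    (by simpa only [hobs] using hiY) (by simpa only [hresid] using hiR) hd
  have hentY := neg_integral_gaussVecLogPDF_add_smul_noise_le (c := 1) hX hZ hXZ hw (by linarith)
  have hentR := neg_integral_gaussVecLogPDF_add_smul_noise_le hR2 hZ hRZ hq
    (by rwa [neg_sq])
  simp only [add_sub_cancel_left, hresid, integral_gaussVecLogPDF_of_hasLaw hT,
    integral_gaussVecLogPDF_of_hasLaw hZ] at key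
  simp only [← hobs] at hentY
  linarith

end GaussianConverse

section BlockLaw

lemma indepFun_of_measurePreserving_prodMk {Ω α β : Type*} [MeasurableSpace Ω]
    [MeasurableSpace α] [MeasurableSpace β] {P : Measure Ω} [IsFiniteMeasure P] {μ : Measure α}
    {ν : Measure β} [IsProbabilityMeasure μ] [IsProbabilityMeasure ν] {X : Ω → α} {Y : Ω → β}
    (h : MeasurePreserving (fun ω => (X ω, Y ω)) P (μ.prod ν)) : X ⟂ᵢ[P] Y :=
  (indepFun_iff_hasLaw_prodMk_prod (measurePreserving_fst.comp h).hasLaw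
    (measurePreserving_snd.comp h).hasLaw).2 h.hasLaw

variable {n N₁ N₂ : ℕ}

lemma blockLaw_eq_map_smul (n N₁ N₂ : ℕ) (Q : ℝ≥0) :
    blockLaw n N₁ N₂ Q =
      (blockLaw n N₁ N₂ 1).map (Prod.map id (Prod.map (fun t => √(Q : ℝ) • t) id)) := by
  have hletter : (gaussianReal 0 1).map (fun x => √(Q : ℝ) * x) = gaussianReal 0 Q := by
    rw [gaussianReal_map_const_mul, mul_zero, mul_one]
    congr 1
    ext
    simp
  have hblock : (Measure.pi fun _ : Fin n => gaussianReal 0 Q) =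
      (Measure.pi fun _ : Fin n => gaussianReal 0 1).map (fun t => √(Q : ℝ) • t) := by
    simp_rw [← hletter]
    exact (Measure.pi_map_pi (f := fun (_ : Fin n) x => √(Q : ℝ) * x) fun _ => by fun_prop).symm
  rw [blockLaw, blockLaw, ← Measure.map_prod_map _ _ measurable_id (by fun_prop),
    ← Measure.map_prod_map _ _ (by fun_prop) measurable_id, hblock, Measure.map_id, Measure.map_id]

lemma uniformOn_univ_fin_singleton {N : ℕ} (m : Fin N) :
    uniformOn (Set.univ : Set (Fin N)) {m} = (N : ℝ≥0∞)⁻¹ := by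
  simp [uniformOn_univ]

variable {Q : ℝ≥0}

lemma measurePreserving_messages : MeasurePreserving (fun ω : Sample n N₁ N₂ => ω.1)
    (blockLaw n N₁ N₂ Q)
    ((uniformOn (Set.univ : Set (Fin N₁))).prod (uniformOn (Set.univ : Set (Fin N₂)))) :=
  measurePreserving_fst

lemma measurePreserving_messages_state :
    MeasurePreserving (fun ω : Sample n N₁ N₂ => (ω.1, ω.2.1)) (blockLaw n N₁ N₂ Q)
      (((uniformOn (Set.univ : Set (Fin N₁))).prod (uniformOn (Set.univ : Set (Fin N₂)))).prod
        (Measure.pi fun _ => gaussianReal 0 Q)) :=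
  (MeasurePreserving.id _).prod measurePreserving_fst

lemma map_message₁_singleton_le [NeZero N₂] (m : Fin N₁) :
    (blockLaw n N₁ N₂ Q).map (fun ω => ω.1.1) {m} ≤ (N₁ : ℝ≥0∞)⁻¹ := by
  have h : MeasurePreserving (fun ω : Sample n N₁ N₂ => ω.1.1) (blockLaw n N₁ N₂ Q)
      (uniformOn Set.univ) := measurePreserving_fst.comp measurePreserving_messages
  rw [h.map_eq, uniformOn_univ_fin_singleton]

lemma map_message₂_singleton_le [NeZero N₁] (m : Fin N₂) :
    (blockLaw n N₁ N₂ Q).map (fun ω => ω.1.2) {m} ≤ (N₂ : ℝ≥0∞)⁻¹ := by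
  have h : MeasurePreserving (fun ω : Sample n N₁ N₂ => ω.1.2) (blockLaw n N₁ N₂ Q)
      (uniformOn Set.univ) := measurePreserving_snd.comp measurePreserving_messages
  rw [h.map_eq, uniformOn_univ_fin_singleton]

lemma map_messages_singleton_le (m : Fin N₁ × Fin N₂) :
    (blockLaw n N₁ N₂ Q).map (fun ω => ω.1) {m} ≤ ((N₁ * N₂ : ℕ) : ℝ≥0∞)⁻¹ := by
  rw [measurePreserving_messages.map_eq, ← Set.singleton_prod_singleton, Measure.prod_prod,
    uniformOn_univ_fin_singleton, uniformOn_univ_fin_singleton, Nat.cast_mul,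
    ENNReal.mul_inv (by simp) (by simp)]

variable [NeZero N₁] [NeZero N₂]

instance (Q : ℝ≥0) : IsProbabilityMeasure (blockLaw n N₁ N₂ Q) := by
  unfold blockLaw; infer_instance

lemma measurePreserving_noise : MeasurePreserving (fun ω : Sample n N₁ N₂ => ω.2.2)
    (blockLaw n N₁ N₂ Q) (Measure.pi fun _ => gaussianReal 0 1) :=
  measurePreserving_snd.comp measurePreserving_snd

lemma measurePreserving_state : MeasurePreserving (fun ω : Sample n N₁ N₂ => ω.2.1)
    (blockLaw n N₁ N₂ Q) (Measure.pi fun _ => gaussianReal 0 Q) :=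
  measurePreserving_fst.comp measurePreserving_snd

lemma indepFun_messages_state_noise :
    (fun ω : Sample n N₁ N₂ => (ω.1, ω.2.1)) ⟂ᵢ[blockLaw n N₁ N₂ Q] fun ω => ω.2.2 :=
  indepFun_of_measurePreserving_prodMk
    ((measurePreserving_prodAssoc _ _ _).symm MeasurableEquiv.prodAssoc)

lemma indepFun_messages_state :
    (fun ω : Sample n N₁ N₂ => ω.1) ⟂ᵢ[blockLaw n N₁ N₂ Q] fun ω => ω.2.1 :=
  indepFun_of_measurePreserving_prodMk measurePreserving_messages_state

lemma indepFun_message₁_message₂_state :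
    (fun ω : Sample n N₁ N₂ => ω.1.1) ⟂ᵢ[blockLaw n N₁ N₂ Q] fun ω => (ω.1.2, ω.2.1) :=
  indepFun_of_measurePreserving_prodMk
    ((measurePreserving_prodAssoc _ _ _).comp measurePreserving_messages_state)

lemma indepFun_message₂_message₁_state :
    (fun ω : Sample n N₁ N₂ => ω.1.2) ⟂ᵢ[blockLaw n N₁ N₂ Q] fun ω => (ω.1.1, ω.2.1) :=
  indepFun_of_measurePreserving_prodMk <| (measurePreserving_prodAssoc _ _ _).comp <|
    (Measure.measurePreserving_swap.prod (MeasurePreserving.id _)).comp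
      measurePreserving_messages_state

end BlockLaw

section GaussRegion

/-- Capacity in nats of the additive white Gaussian noise channel with signal-to-noise ratio `s`. -/
def awgnCapacity (s : ℝ) : ℝ := Real.log (1 + s) / 2

/-- Rate pairs satisfying the three bounds of the single-letter region for Gaussian inputs, where
`ρ` is the correlation between the first input and the state divided by its standard deviation. -/
def gaussRegion (P₁ P₂ Q : ℝ≥0) : Set (ℝ × ℝ) :=
  {R | ∃ ρ : ℝ, ρ ^ 2 ≤ P₁ ∧ R.1 ≤ awgnCapacity (P₁ - ρ ^ 2) ∧ R.2 ≤ awgnCapacity P₂ ∧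
    R.1 + R.2 ≤
      awgnCapacity (P₁ - ρ ^ 2) + awgnCapacity (P₂ / (1 + (P₁ - ρ ^ 2) + (ρ + √Q) ^ 2))}

lemma isLowerSet_gaussRegion (P₁ P₂ Q : ℝ≥0) : IsLowerSet (gaussRegion P₁ P₂ Q) :=
  fun _ _ hle ⟨ρ, hρ, h₁, h₂, h₁₂⟩ =>
    ⟨ρ, hρ, hle.1.trans h₁, hle.2.trans h₂, (add_le_add hle.1 hle.2).trans h₁₂⟩

lemma continuousOn_awgnCapacity : ContinuousOn awgnCapacity (Set.Ici 0) :=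
  ((continuousOn_const.add continuousOn_id).log fun s (hs : 0 ≤ s) =>
    (by linarith [hs] : (0 : ℝ) < 1 + s).ne').div_const 2

lemma isClosed_gaussRegion (P₁ P₂ Q : ℝ≥0) : IsClosed (gaussRegion P₁ P₂ Q) := by
  let K : Set ℝ := {ρ | ρ ^ 2 ≤ P₁}
  have hK : K = Set.Icc (-√(P₁ : ℝ)) √(P₁ : ℝ) := Set.ext fun ρ => Real.sq_le P₁.2
  have : CompactSpace K := isCompact_iff_compactSpace.1 (hK ▸ isCompact_Icc)
  have hvar : ∀ ρ : K, (0 : ℝ) ≤ P₁ - (ρ : ℝ) ^ 2 := fun ρ => sub_nonneg.2 ρ.2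
  have hden : ∀ ρ : K, 0 < 1 + (P₁ - (ρ : ℝ) ^ 2) + (ρ + √Q) ^ 2 := fun ρ => by
    have := hvar ρ
    positivity
  have hcapacity₁ : Continuous fun ρ : K => awgnCapacity (P₁ - (ρ : ℝ) ^ 2) :=
    continuousOn_awgnCapacity.comp_continuous (by fun_prop) hvar
  have hcapacity₂ :
      Continuous fun ρ : K => awgnCapacity (P₂ / (1 + (P₁ - (ρ : ℝ) ^ 2) + (ρ + √Q) ^ 2)) :=
    continuousOn_awgnCapacity.comp_continuous
      (continuous_const.div (by fun_prop) fun ρ => (hden ρ).ne')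
      fun ρ => div_nonneg P₂.2 (hden ρ).le
  have hclosed : IsClosed {p : K × (ℝ × ℝ) | p.2.1 ≤ awgnCapacity (P₁ - (p.1 : ℝ) ^ 2) ∧
      p.2.2 ≤ awgnCapacity P₂ ∧ p.2.1 + p.2.2 ≤ awgnCapacity (P₁ - (p.1 : ℝ) ^ 2) +
        awgnCapacity (P₂ / (1 + (P₁ - (p.1 : ℝ) ^ 2) + (p.1 + √Q) ^ 2))} := by
    simp only [Set.ofPred_and]
    exact (isClosed_le (by fun_prop) (hcapacity₁.comp continuous_fst)).inter
      ((isClosed_le (by fun_prop) (by fun_prop)).inter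
        (isClosed_le (by fun_prop) ((hcapacity₁.add hcapacity₂).comp continuous_fst)))
  convert isClosedMap_snd_of_compactSpace _ hclosed using 1
  ext R
  constructor
  · rintro ⟨ρ, hρ, h⟩
    exact ⟨(⟨ρ, hρ⟩, R), h, rfl⟩
  · rintro ⟨⟨ρ, R'⟩, h, rfl⟩
    exact ⟨ρ, ρ.2, h⟩

end GaussRegion

section CodeBounds

namespace Code

variable {n N₁ N₂ : ℕ}

/-- The code that encodes the state `k • t` whenever the state is `t`: it turns a code for states of
variance `k ^ 2` into a code driven by standard normal states. -/
def rescale (c : Code n N₁ N₂) (k : ℝ) : Code n N₁ N₂ where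
  enc₁ m t := c.enc₁ m (k • t)
  measurable_enc₁ m := (c.measurable_enc₁ m).comp (measurable_const_smul k)
  enc₂ := c.enc₂
  dec := c.dec
  measurable_dec := c.measurable_dec

/-- The probability of correct decoding when the additive state is `k` times a standard normal
sequence, the latter being what encoder 1 observes. -/
def correctProb (c : Code n N₁ N₂) (k : ℝ) : ℝ :=
  (blockLaw n N₁ N₂ 1).real {ω | c.dec (c.input₁ ω + k • ω.2.1 + c.input₂ ω + ω.2.2) = ω.1}

@[fun_prop]
lemma measurable_uncurry_enc₁ (c : Code n N₁ N₂) :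
    Measurable fun p : Fin N₁ × (Fin n → ℝ) => c.enc₁ p.1 p.2 :=
  measurable_from_prod_countable_right c.measurable_enc₁

@[fun_prop]
lemma measurable_input₁ (c : Code n N₁ N₂) : Measurable c.input₁ :=
  c.measurable_uncurry_enc₁.comp (by fun_prop : Measurable fun ω : Sample n N₁ N₂ => (ω.1.1, ω.2.1))

@[fun_prop]
lemma measurable_input₂ (c : Code n N₁ N₂) : Measurable c.input₂ :=
  (measurable_of_countable c.enc₂).comp (by fun_prop : Measurable fun ω : Sample n N₁ N₂ => ω.1.2)

attribute [fun_prop] measurable_dec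

lemma memLp_input₂ (c : Code n N₁ N₂) (Q : ℝ≥0) : MemLp c.input₂ 2 (blockLaw n N₁ N₂ Q) :=
  (MemLp.of_discrete (f := fun m : Fin N₁ × Fin N₂ => c.enc₂ m.2)).comp_measurePreserving
    measurePreserving_messages

variable [NeZero N₁] [NeZero N₂]

lemma energy_smul_input₁_add_smul_state (c : Code n N₁ N₂)
    (hX : MemLp c.input₁ 2 (blockLaw n N₁ N₂ 1)) (α β : ℝ) :
    energy (fun ω => α • c.input₁ ω + β • ω.2.1) (blockLaw n N₁ N₂ 1) =
      α ^ 2 * energy c.input₁ (blockLaw n N₁ N₂ 1) +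
        2 * α * β * correlation c.input₁ (fun ω => ω.2.1) (blockLaw n N₁ N₂ 1) + β ^ 2 * n := by
  have hT := measurePreserving_state (n := n) (N₁ := N₁) (N₂ := N₂) (Q := 1)
  rw [energy_smul_add_smul hX (memLp_two_of_hasLaw_pi_gaussianReal hT.hasLaw),
    energy_of_hasLaw_pi_gaussianReal hT.hasLaw, NNReal.coe_one, mul_one]

lemma correctProb_mul_log_le₁ (c : Code n N₁ N₂) (k : ℝ)
    (hX : MemLp c.input₁ 2 (blockLaw n N₁ N₂ 1)) (ρ : ℝ) {D : ℝ} (hD : 0 < D)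
    (hXD : energy (fun ω => c.input₁ ω - ρ • ω.2.1) (blockLaw n N₁ N₂ 1) + n ≤ n * D) :
    c.correctProb k * Real.log N₁ ≤ n / 2 * Real.log D + 1 := by
  have hT2 := memLp_two_of_hasLaw_pi_gaussianReal
    (measurePreserving_state (n := n) (N₁ := N₁) (N₂ := N₂) (Q := 1)).hasLaw
  have hXT : MemLp (fun ω => c.input₁ ω - ρ • ω.2.1) 2 (blockLaw n N₁ N₂ 1) :=
    hX.sub (hT2.const_smul ρ)
  let f : Fin N₁ × Fin N₂ × (Fin n → ℝ) → Fin n → ℝ :=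
    fun p => c.enc₁ p.1 p.2.2 + k • p.2.2 + c.enc₂ p.2.1
  let g : Fin N₂ × (Fin n → ℝ) → Fin n → ℝ := fun b => c.enc₂ b.1 + (ρ + k) • b.2
  have henc₂ : Measurable c.enc₂ := measurable_of_countable _
  have hf : Measurable f := by fun_prop
  have hg : Measurable g := by fun_prop
  have hresid : ∀ ω : Sample n N₁ N₂, f (ω.1.1, ω.1.2, ω.2.1) - g (ω.1.2, ω.2.1) =
      c.input₁ ω - ρ • ω.2.1 := fun ω => by
    simp only [f, g, input₁, add_smul]; abel
  have hMBZ : (fun ω : Sample n N₁ N₂ => (ω.1.1, ω.1.2, ω.2.1)) ⟂ᵢ[blockLaw n N₁ N₂ 1]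
      fun ω => ω.2.2 :=
    indepFun_messages_state_noise.comp MeasurableEquiv.prodAssoc.measurable measurable_id
  have hd : Measurable fun p : (Fin N₂ × (Fin n → ℝ)) × (Fin n → ℝ) => (c.dec p.2).1 := by fun_prop
  have key := correct_mul_log_le_of_gaussian_sideInfo (by fun_prop) (by fun_prop)
    indepFun_message₁_message₂_state map_message₁_singleton_le measurePreserving_noise.hasLaw
    hMBZ hf hg (by simpa only [hresid] using hXT) hD
    (by simpa only [hresid] using hXD) hd
  refine le_trans ?_ key
  gcongr
  exact measureReal_mono fun ω hω => congrArg Prod.fst hω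

lemma correctProb_mul_log_le₂ (c : Code n N₁ N₂) (k : ℝ) {D : ℝ} (hD : 0 < D)
    (hXD : energy c.input₂ (blockLaw n N₁ N₂ 1) + n ≤ n * D) :
    c.correctProb k * Real.log N₂ ≤ n / 2 * Real.log D + 1 := by
  let g : Fin N₁ × (Fin n → ℝ) → Fin n → ℝ := fun b => c.enc₁ b.1 b.2 + k • b.2
  let f : Fin N₂ × Fin N₁ × (Fin n → ℝ) → Fin n → ℝ := fun p => g p.2 + c.enc₂ p.1
  have henc₂ : Measurable c.enc₂ := measurable_of_countable _
  have hg : Measurable g := by fun_prop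
  have hf : Measurable f := by fun_prop
  have hresid : ∀ ω : Sample n N₁ N₂, f (ω.1.2, ω.1.1, ω.2.1) - g (ω.1.1, ω.2.1) =
      c.input₂ ω := fun ω => add_sub_cancel_left _ _
  have hMBZ : (fun ω : Sample n N₁ N₂ => (ω.1.2, ω.1.1, ω.2.1)) ⟂ᵢ[blockLaw n N₁ N₂ 1]
      fun ω => ω.2.2 :=
    indepFun_messages_state_noise.comp (φ := fun p => (p.1.2, p.1.1, p.2)) (by fun_prop)
      measurable_id
  have hd : Measurable fun p : (Fin N₁ × (Fin n → ℝ)) × (Fin n → ℝ) => (c.dec p.2).2 := by fun_prop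
  have key := correct_mul_log_le_of_gaussian_sideInfo (by fun_prop) (by fun_prop)
    indepFun_message₂_message₁_state map_message₂_singleton_le measurePreserving_noise.hasLaw
    hMBZ hf hg (by simpa only [hresid] using c.memLp_input₂ 1) hD
    (by simpa only [hresid] using hXD) hd
  refine le_trans ?_ key
  gcongr
  exact measureReal_mono fun ω hω => congrArg Prod.snd hω

lemma correctProb_mul_log_mul_le (c : Code n N₁ N₂) (k : ℝ)
    (hX : MemLp c.input₁ 2 (blockLaw n N₁ N₂ 1)) {w q b : ℝ} (hw : 0 < w) (hq : 0 < q)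
    (hXw : energy (fun ω => c.input₁ ω + k • ω.2.1) (blockLaw n N₁ N₂ 1) +
      energy c.input₂ (blockLaw n N₁ N₂ 1) + n ≤ n * w)
    (hTq : energy (fun ω => ω.2.1 - b • (c.input₁ ω + k • ω.2.1)) (blockLaw n N₁ N₂ 1) +
      b ^ 2 * n ≤ n * q) :
    c.correctProb k * Real.log (N₁ * N₂) ≤ n / 2 * (Real.log w + Real.log q) + 1 := by
  set μ := blockLaw n N₁ N₂ 1
  have hT : HasLaw (fun ω : Sample n N₁ N₂ => ω.2.1) _ μ := measurePreserving_state.hasLaw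
  have hX₁ : MemLp (fun ω => c.input₁ ω + k • ω.2.1) 2 μ :=
    hX.add ((memLp_two_of_hasLaw_pi_gaussianReal hT).const_smul k)
  -- The decoder knows the mean of the second input, so its energy counts only through the variance.
  let e : Fin n → ℝ := fun i => ∫ ω, c.input₂ ω i ∂μ
  let g : Fin N₁ × Fin N₂ → Fin n → ℝ := fun m => c.enc₂ m.2 - e
  let f : (Fin N₁ × Fin N₂) × (Fin n → ℝ) → Fin n → ℝ :=
    fun p => c.enc₁ p.1.1 p.2 + k • p.2 + g p.1
  have hg : Measurable g := measurable_of_countable _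
  have hf : Measurable f := by fun_prop
  have hg2 : MemLp (fun ω => g ω.1) 2 μ := (c.memLp_input₂ 1).sub (memLp_const e)
  have hindep : (fun ω => c.input₁ ω + k • ω.2.1) ⟂ᵢ[μ] fun ω => g ω.1 :=
    (indepFun_message₂_message₁_state.comp (φ := fun m => c.enc₂ m - e)
      (ψ := fun p => c.enc₁ p.1 p.2 + k • p.2) (measurable_of_countable _) (by fun_prop)).symm
  have hg0 : ∀ i, ∫ ω, g ω.1 i ∂μ = 0 := fun i => by
    have hi : Integrable (fun ω => c.input₂ ω i) μ :=
      ((c.memLp_input₂ 1).eval i).integrable one_le_two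
    exact (integral_sub hi (integrable_const _)).trans (by simp [e])
  have hfe : energy (fun ω => f (ω.1, ω.2.1)) μ + n ≤ n * w := by
    have h := energy_add_smul_of_indepFun hX₁ hg2 hindep hg0 1
    simp only [one_smul] at h
    have hsum : energy (fun ω => f (ω.1, ω.2.1)) μ = _ := h
    have hcentered : energy (fun ω => g ω.1) μ ≤ energy c.input₂ μ :=
      energy_sub_integral_le (c.memLp_input₂ 1)
    linarith
  have hd : Measurable fun y => c.dec (y + e) := by fun_prop
  have key := correct_mul_log_le_of_gaussian_posterior (by fun_prop) indepFun_messages_state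
    map_messages_singleton_le hT measurePreserving_noise.hasLaw indepFun_messages_state_noise hf
    (hX₁.add hg2) hg hg2 hw hq hfe (b := b)
    (by simpa only [f, add_sub_cancel_right, input₁] using hTq) hd
  rw [Nat.cast_mul] at key
  have hout : ∀ ω, f (ω.1, ω.2.1) + ω.2.2 + e =
      c.input₁ ω + k • ω.2.1 + c.input₂ ω + ω.2.2 := fun ω => by
    simp only [f, g, input₁, input₂]; abel
  simpa only [hout, correctProb] using key

end Code

end CodeBounds

section FiniteBlocklength

lemma memLp_two_and_energy_le {Ω ι : Type*} [MeasurableSpace Ω] [Fintype ι] {μ : Measure Ω}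
    {X : Ω → ι → ℝ} (hX : Measurable X) {C : ℝ≥0}
    (h : ∑ i, ∫⁻ ω, ENNReal.ofReal (X ω i ^ 2) ∂μ ≤ C) : MemLp X 2 μ ∧ energy X μ ≤ C := by
  have hi : ∀ i, Integrable (fun ω => X ω i ^ 2) μ := fun i => by
    refine ⟨by fun_prop, ?_⟩
    rw [hasFiniteIntegral_iff_ofReal (ae_of_all _ fun ω => sq_nonneg _)]
    exact (ENNReal.sum_lt_top.1 (h.trans_lt ENNReal.coe_lt_top)) i (Finset.mem_univ i)
  refine ⟨MemLp.of_eval fun i => (memLp_two_iff_integrable_sq (by fun_prop)).2 (hi i), ?_⟩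
  have henergy : ENNReal.ofReal (energy X μ) = ∑ i, ∫⁻ ω, ENNReal.ofReal (X ω i ^ 2) ∂μ := by
    rw [energy, ENNReal.ofReal_sum_of_nonneg fun i _ => integral_nonneg fun ω => sq_nonneg _]
    exact Finset.sum_congr rfl fun i _ =>
      ofReal_integral_eq_lintegral_ofReal (hi i) (ae_of_all _ fun ω => sq_nonneg _)
  rw [← henergy] at h
  exact (ENNReal.ofReal_le_iff_le_toReal ENNReal.coe_ne_top).1 h

namespace Code

variable {n N₁ N₂ : ℕ}

lemma measurePreserving_smul_state (Q : ℝ≥0) :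
    MeasurePreserving (fun ω : Sample n N₁ N₂ => (ω.1, √(Q : ℝ) • ω.2.1, ω.2.2))
      (blockLaw n N₁ N₂ 1) (blockLaw n N₁ N₂ Q) :=
  ⟨by fun_prop, (blockLaw_eq_map_smul n N₁ N₂ Q).symm⟩

variable {P₁ P₂ Q : ℝ≥0}

lemma SatisfiesPower.input₁_rescale {c : Code n N₁ N₂} (hp : c.SatisfiesPower P₁ P₂ Q) :
    MemLp (c.rescale √Q).input₁ 2 (blockLaw n N₁ N₂ 1) ∧
      energy (c.rescale √Q).input₁ (blockLaw n N₁ N₂ 1) ≤ n * P₁ := by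
  have hφ := measurePreserving_smul_state (n := n) (N₁ := N₁) (N₂ := N₂) Q
  have h : ∑ i, ∫⁻ ω, ENNReal.ofReal ((c.rescale √Q).input₁ ω i ^ 2) ∂(blockLaw n N₁ N₂ 1) ≤
      (n * P₁ : ℝ≥0) := by
    have hi : ∀ i, Measurable fun ω => ENNReal.ofReal (c.input₁ ω i ^ 2) := fun i => by fun_prop
    push_cast
    refine le_of_eq_of_le (Finset.sum_congr rfl fun i _ => ?_) hp.1
    exact hφ.lintegral_comp (hi i)
  exact_mod_cast memLp_two_and_energy_le (c.rescale √Q).measurable_input₁ h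

lemma SatisfiesPower.energy_input₂_rescale_le {c : Code n N₁ N₂} (hp : c.SatisfiesPower P₁ P₂ Q) :
    energy (c.rescale √Q).input₂ (blockLaw n N₁ N₂ 1) ≤ n * P₂ := by
  have hφ := measurePreserving_smul_state (n := n) (N₁ := N₁) (N₂ := N₂) Q
  have h : ∑ i, ∫⁻ ω, ENNReal.ofReal ((c.rescale √Q).input₂ ω i ^ 2) ∂(blockLaw n N₁ N₂ 1) ≤
      (n * P₂ : ℝ≥0) := by
    have hi : ∀ i, Measurable fun ω => ENNReal.ofReal (c.input₂ ω i ^ 2) := fun i => by fun_prop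
    push_cast
    refine le_of_eq_of_le (Finset.sum_congr rfl fun i _ => ?_) hp.2
    exact hφ.lintegral_comp (hi i)
  exact_mod_cast (memLp_two_and_energy_le (c.rescale √Q).measurable_input₂ h).2

variable [NeZero N₁] [NeZero N₂]

lemma one_sub_errorProb_toReal (c : Code n N₁ N₂) (Q : ℝ≥0) :
    1 - (c.errorProb Q).toReal = (c.rescale √Q).correctProb √Q := by
  have hφ := measurePreserving_smul_state (n := n) (N₁ := N₁) (N₂ := N₂) Q
  have hout : Measurable c.output := by
    unfold output; fun_prop
  have hE : MeasurableSet {ω | c.dec (c.output ω) ≠ ω.1} :=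
    (measurableSet_eq_fun (c.measurable_dec.comp hout) measurable_fst).compl
  rw [errorProb, ← hφ.measure_preimage hE.nullMeasurableSet, ← measureReal_def,
    ← probReal_compl_eq_one_sub (hφ.measurable hE), correctProb]
  congr 1 with ω
  have h : (c.rescale √Q).input₁ ω + √(Q : ℝ) • ω.2.1 + (c.rescale √Q).input₂ ω + ω.2.2 =
      c.output (ω.1, √(Q : ℝ) • ω.2.1, ω.2.2) := funext fun i => by
    simp [input₁, input₂, output, rescale]; ring
  rw [Set.mem_ofPred_eq, h]
  exact not_not

end Code

end FiniteBlocklength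

section FiniteBlocklengthRegion

namespace Code

variable {n N₁ N₂ : ℕ} [NeZero N₁] [NeZero N₂] {P₁ P₂ Q : ℝ≥0}

lemma exists_correlation (c : Code n N₁ N₂) (hn : n ≠ 0)
    (hX : MemLp c.input₁ 2 (blockLaw n N₁ N₂ 1))
    (hP : energy c.input₁ (blockLaw n N₁ N₂ 1) ≤ n * P₁) :
    ∃ ρ : ℝ, ρ ^ 2 ≤ P₁ ∧ ∀ α β : ℝ,
      energy (fun ω => α • c.input₁ ω + β • ω.2.1) (blockLaw n N₁ N₂ 1) ≤
        n * (α ^ 2 * P₁ + 2 * α * β * ρ + β ^ 2) := by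
  have hn0 : (0 : ℝ) < n := Nat.cast_pos.2 (Nat.pos_of_ne_zero hn)
  obtain ⟨ρ, hρ⟩ : ∃ ρ : ℝ,
      correlation c.input₁ (fun ω => ω.2.1) (blockLaw n N₁ N₂ 1) = n * ρ :=
    ⟨_, (mul_div_cancel₀ _ hn0.ne').symm⟩
  have henergy : ∀ α β : ℝ,
      energy (fun ω => α • c.input₁ ω + β • ω.2.1) (blockLaw n N₁ N₂ 1) ≤
        n * (α ^ 2 * P₁ + 2 * α * β * ρ + β ^ 2) := fun α β => by
    rw [c.energy_smul_input₁_add_smul_state hX, hρ]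
    linarith [mul_le_mul_of_nonneg_left hP (sq_nonneg α)]
  have hresid := energy_nonneg.trans (henergy 1 (-ρ))
  exact ⟨ρ, by linarith [nonneg_of_mul_nonneg_right hresid hn0], henergy⟩

lemma correctProb_mul_log_mul_le_awgnCapacity (c : Code n N₁ N₂) (k : ℝ)
    (hX : MemLp c.input₁ 2 (blockLaw n N₁ N₂ 1)) {ρ : ℝ} (hρ : ρ ^ 2 ≤ P₁)
    (henergy : ∀ α β : ℝ, energy (fun ω => α • c.input₁ ω + β • ω.2.1) (blockLaw n N₁ N₂ 1) ≤
      n * (α ^ 2 * P₁ + 2 * α * β * ρ + β ^ 2))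
    (hP₂ : energy c.input₂ (blockLaw n N₁ N₂ 1) ≤ n * P₂) :
    c.correctProb k * Real.log (N₁ * N₂) ≤
      n * (awgnCapacity (P₁ - ρ ^ 2) + awgnCapacity (P₂ / (1 + (P₁ - ρ ^ 2) + (ρ + k) ^ 2))) +
        1 := by
  set D : ℝ := 1 + (P₁ - ρ ^ 2) with hD
  set v : ℝ := D + (ρ + k) ^ 2 with hv
  have hD0 : 0 < D := by linarith
  have hv0 : 0 < v := by positivity
  -- `b • Y` is the linear minimum mean square error estimate of the state given `Y` and `X₂`.
  obtain ⟨b, hb⟩ : ∃ b : ℝ, b * v = ρ + k := ⟨(ρ + k) / v, div_mul_cancel₀ _ hv0.ne'⟩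
  have hDv : D / v = 1 - b * (ρ + k) := by
    rw [div_eq_iff hv0.ne', sub_mul, mul_right_comm, hb, hv]
    ring
  have hX₁ : energy (fun ω => c.input₁ ω + k • ω.2.1) (blockLaw n N₁ N₂ 1) ≤
      n * (P₁ + 2 * k * ρ + k ^ 2) := by
    simpa only [one_smul, one_pow, one_mul, mul_one] using henergy 1 k
  have hT : energy (fun ω => ω.2.1 - b • (c.input₁ ω + k • ω.2.1)) (blockLaw n N₁ N₂ 1) ≤
      n * ((-b) ^ 2 * P₁ + 2 * -b * (1 - b * k) * ρ + (1 - b * k) ^ 2) := by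
    convert henergy (-b) (1 - b * k) using 3 with ω
    module
  have key := c.correctProb_mul_log_mul_le k hX (w := v + P₂) (q := D / v) (b := b)
    (by positivity) (by positivity) (by linear_combination hX₁ + hP₂)
    (by rw [hDv]; linear_combination hT + (n : ℝ) * b * hb)
  have hlog : Real.log (v + P₂) + Real.log (D / v) = Real.log D + Real.log (1 + P₂ / v) := by
    rw [← Real.log_mul (by positivity) (by positivity),
      ← Real.log_mul (by positivity) (by positivity)]
    congr 1
    field_simp
  rw [hlog] at key
  refine key.trans_eq ?_
  rw [awgnCapacity, awgnCapacity, ← hD]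
  ring

lemma mem_gaussRegion (c : Code n N₁ N₂) (hn : n ≠ 0) (hp : c.SatisfiesPower P₁ P₂ Q) :
    (((1 - (c.errorProb Q).toReal) * Real.log N₁ - 1) / n,
      ((1 - (c.errorProb Q).toReal) * Real.log N₂ - 1) / n) ∈ gaussRegion P₁ P₂ Q := by
  have hn0 : (0 : ℝ) < n := Nat.cast_pos.2 (Nat.pos_of_ne_zero hn)
  obtain ⟨hX, hP₁⟩ := hp.input₁_rescale
  obtain ⟨ρ, hρ, henergy⟩ := (c.rescale √Q).exists_correlation hn hX hP₁
  have hP₂ := hp.energy_input₂_rescale_le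
  have hresid : energy (fun ω => (c.rescale √Q).input₁ ω - ρ • ω.2.1) (blockLaw n N₁ N₂ 1) ≤
      n * (P₁ - ρ ^ 2) := by
    convert henergy 1 (-ρ) using 2
    · simp only [one_smul, neg_smul, sub_eq_add_neg]
    · ring
  have bound₁ := (c.rescale √Q).correctProb_mul_log_le₁ √Q hX ρ (D := 1 + (P₁ - ρ ^ 2))
    (by linarith) (by linarith)
  have bound₂ := (c.rescale √Q).correctProb_mul_log_le₂ √Q (D := 1 + P₂) (by positivity)
    (by linarith)
  have bound₁₂ := (c.rescale √Q).correctProb_mul_log_mul_le_awgnCapacity √Q hX hρ henergy hP₂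
  rw [Real.log_mul (by simp [NeZero.ne]) (by simp [NeZero.ne])] at bound₁₂
  rw [one_sub_errorProb_toReal]
  refine ⟨ρ, hρ, ?_, ?_, ?_⟩
  · rw [div_le_iff₀ hn0, awgnCapacity]
    linarith
  · rw [div_le_iff₀ hn0, awgnCapacity]
    linarith
  · rw [← add_div, div_le_iff₀ hn0]
    linarith

end Code

lemma Achievable.mem_gaussRegion {P₁ P₂ Q : ℝ≥0} {R₁ R₂ : ℝ} (h : Achievable P₁ P₂ Q R₁ R₂) :
    (R₁, R₂) ∈ gaussRegion P₁ P₂ Q := by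
  obtain ⟨-, -, N₁, N₂, c, hc, herr⟩ := h
  have hε : Tendsto (fun n => ((c n).errorProb Q).toReal) atTop (𝓝 0) :=
    (ENNReal.tendsto_toReal ENNReal.zero_ne_top).comp herr
  have hlim : ∀ R : ℝ, Tendsto (fun n : ℕ => (1 - ((c n).errorProb Q).toReal) * R - 1 / n) atTop
      (𝓝 R) := fun R => by
    simpa using (((tendsto_const_nhds (x := (1 : ℝ))).sub hε).mul_const R).sub
      (tendsto_one_div_atTop_nhds_zero_nat (𝕜 := ℝ))
  refine (isClosed_gaussRegion P₁ P₂ Q).mem_of_tendsto ((hlim R₁).prodMk_nhds (hlim R₂)) ?_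
  filter_upwards [eventually_ne_atTop 0] with n hn
  obtain ⟨hN₁, hN₂, hp⟩ := hc n
  have hpos : ∀ {N : ℕ} {R : ℝ}, Real.exp (n * R) ≤ N → NeZero N := fun {N R} h =>
    ⟨by rintro rfl; exact absurd h (by simp [Real.exp_pos])⟩
  have := hpos hN₁
  have := hpos hN₂
  have hcorrect : 0 ≤ 1 - ((c n).errorProb Q).toReal := by
    rw [Code.one_sub_errorProb_toReal]
    exact measureReal_nonneg
  have hrate : ∀ {N : ℕ} {R : ℝ}, Real.exp (n * R) ≤ N →
      (1 - ((c n).errorProb Q).toReal) * R - 1 / n ≤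
        ((1 - ((c n).errorProb Q).toReal) * Real.log N - 1) / n := fun {N R} h => by
    have hlog : R * n ≤ Real.log N := by
      rw [Real.le_log_iff_exp_le ((Real.exp_pos _).trans_le h), mul_comm]
      exact h
    rw [sub_div, mul_div_assoc]
    gcongr
    rwa [le_div_iff₀ (Nat.cast_pos.2 (Nat.pos_of_ne_zero hn))]
  exact isLowerSet_gaussRegion _ _ _ ⟨hrate hN₁, hrate hN₂⟩ ((c n).mem_gaussRegion hn hp)

lemma capacityRegion_subset_gaussRegion (P₁ P₂ Q : ℝ≥0) :
    capacityRegion P₁ P₂ Q ⊆ gaussRegion P₁ P₂ Q :=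
  closure_minimal (fun _ hR => hR.mem_gaussRegion) (isClosed_gaussRegion P₁ P₂ Q)

lemma capacityRegion_subset_Ici (P₁ P₂ Q : ℝ≥0) : capacityRegion P₁ P₂ Q ⊆ Set.Ici 0 :=
  closure_minimal (fun _ hR => ⟨hR.1, hR.2.1⟩) isClosed_Ici

end FiniteBlocklengthRegion

section GaussianInformation

variable {Ω α γ : Type*} [MeasurableSpace Ω] [MeasurableSpace α] [MeasurableSpace γ] {μ : Measure Ω}

lemma hasLaw_add_gaussianReal {X V : Ω → ℝ} {s r : ℝ≥0} (hX : HasLaw X (gaussianReal 0 s) μ)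
    (hV : HasLaw V (gaussianReal 0 r) μ) (hXV : X ⟂ᵢ[μ] V) :
    HasLaw (fun ω => X ω + V ω) (gaussianReal 0 (s + r)) μ := by
  simpa only [gaussianReal_conv_gaussianReal, add_zero] using hXV.hasLaw_fun_add hX hV

lemma lintegral_ofReal_sq_of_hasLaw_gaussianReal {V : Ω → ℝ} {v : ℝ≥0}
    (hV : HasLaw V (gaussianReal 0 v) μ) : ∫⁻ ω, ENNReal.ofReal (V ω ^ 2) ∂μ = v := by
  rw [← ofReal_integral_eq_lintegral_ofReal (memLp_two_of_hasLaw_gaussianReal hV).integrable_sq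
    (ae_of_all _ fun ω => sq_nonneg (V ω)), integral_sq_of_hasLaw_gaussianReal hV,
    ENNReal.ofReal_coe_nnreal]

variable [IsProbabilityMeasure μ]

lemma integral_gaussLogPDF_of_hasLaw {V : Ω → ℝ} {v : ℝ≥0} (hv : v ≠ 0)
    (hV : HasLaw V (gaussianReal 0 v) μ) :
    ∫ ω, gaussLogPDF v (V ω) ∂μ = -(Real.log (2 * Real.pi * v) / 2) - 1 / 2 := by
  have hv' : (v : ℝ) ≠ 0 := NNReal.coe_ne_zero.2 hv
  rw [integral_gaussLogPDF (memLp_two_of_hasLaw_gaussianReal hV),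
    integral_sq_of_hasLaw_gaussianReal hV]
  field_simp

lemma integral_gaussLogPDF_sub_integral_gaussLogPDF {V V' : Ω → ℝ} {r s : ℝ≥0} (hr : r ≠ 0)
    (hV : HasLaw V (gaussianReal 0 r) μ) (hV' : HasLaw V' (gaussianReal 0 (r + s)) μ) :
    ∫ ω, gaussLogPDF r (V ω) ∂μ - ∫ ω, gaussLogPDF ((r + s : ℝ≥0) : ℝ) (V' ω) ∂μ =
      awgnCapacity (s / r) := by
  have hr' : (0 : ℝ) < r := NNReal.coe_pos.2 (pos_iff_ne_zero.2 hr)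
  have hsum : (1 + s / r : ℝ) = (r + s) / r := by field_simp
  have hpi : (0 : ℝ) < 2 * Real.pi := by positivity
  rw [integral_gaussLogPDF_of_hasLaw hr hV, integral_gaussLogPDF_of_hasLaw (by positivity) hV',
    awgnCapacity, NNReal.coe_add, hsum, Real.log_div (by positivity) hr'.ne',
    Real.log_mul hpi.ne' hr'.ne', Real.log_mul hpi.ne' (by positivity)]
  ring

lemma le_condMutualInfo_of_gaussian_noise [StandardBorelSpace α] [Nonempty α] {X : Ω → α}
    {Y V V' : Ω → ℝ} {W : Ω → γ} {r s : ℝ≥0} (hX : AEMeasurable X μ) (hW : AEMeasurable W μ)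
    (hr : r ≠ 0) (hV : HasLaw V (gaussianReal 0 r) μ)
    (hV' : HasLaw V' (gaussianReal 0 (r + s)) μ) (hXV : (fun ω => (W ω, X ω)) ⟂ᵢ[μ] V)
    (hWV' : W ⟂ᵢ[μ] V') {f : γ × α → ℝ} (hf : Measurable f) {g : γ → ℝ} (hg : Measurable g)
    (hY : ∀ ω, Y ω = f (W ω, X ω) + V ω) (hY' : ∀ ω, Y ω = g (W ω) + V' ω) :
    ENNReal.ofReal (awgnCapacity (s / r)) ≤ condMutualInfo X Y W μ := by
  have hrs : r + s ≠ 0 := by positivity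
  have hVr := hV
  have hVrs := hV'
  rw [gaussianReal_eq_withLogDensity hr] at hVr
  rw [gaussianReal_eq_withLogDensity hrs] at hVrs
  have hWXY := hasCondLogDensity_add_of_indepFun (hW.prodMk hX) hXV hVr hf (by fun_prop)
  have hWY := hasCondLogDensity_add_of_indepFun hW hWV' hVrs hg (by fun_prop)
  simp only [← hY] at hWXY
  simp only [← hY'] at hWY
  have hresid : ∀ ω, Y ω - f (W ω, X ω) = V ω := fun ω => by rw [hY, add_sub_cancel_left]
  have hresid' : ∀ ω, Y ω - g (W ω) = V' ω := fun ω => by rw [hY', add_sub_cancel_left]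
  have hYm : AEMeasurable Y μ := by
    rw [funext hY']
    exact (hg.comp_aemeasurable hW).add hV'.aemeasurable
  have key := le_condMutualInfo_of_logDensity hX hYm hW (by fun_prop) (by fun_prop) hWXY hWY
    (by simpa only [hresid] using integrable_gaussLogPDF (memLp_two_of_hasLaw_gaussianReal hV) r)
    (by simpa only [hresid'] using
      integrable_gaussLogPDF (memLp_two_of_hasLaw_gaussianReal hV') _)
  simp only [hresid, hresid'] at key
  rwa [integral_gaussLogPDF_sub_integral_gaussLogPDF hr hV hV'] at key

lemma mutualInfo_add_gaussian_noise {X V : Ω → ℝ} {r s : ℝ≥0} (hr : r ≠ 0)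
    (hX : HasLaw X (gaussianReal 0 s) μ) (hV : HasLaw V (gaussianReal 0 r) μ) (hXV : X ⟂ᵢ[μ] V) :
    mutualInfo X (fun ω => X ω + V ω) μ = ENNReal.ofReal (awgnCapacity (s / r)) := by
  have hrs : r + s ≠ 0 := by positivity
  have hY : HasLaw (fun ω => X ω + V ω) (gaussianReal 0 (r + s)) μ :=
    add_comm s r ▸ hasLaw_add_gaussianReal hX hV hXV
  have hVr := hV
  have hYr := hY
  rw [gaussianReal_eq_withLogDensity hr] at hVr
  rw [gaussianReal_eq_withLogDensity hrs] at hYr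
  have hXY := hasCondLogDensity_add_of_indepFun hX.aemeasurable hXV hVr measurable_id
    (by fun_prop)
  have key := mutualInfo_eq_of_logDensity hX.aemeasurable (by fun_prop) (by fun_prop) hXY hYr
    (by simpa only [id, add_sub_cancel_left] using
      integrable_gaussLogPDF (memLp_two_of_hasLaw_gaussianReal hV) r)
    (integrable_gaussLogPDF (memLp_two_of_hasLaw_gaussianReal hY) _)
  simp only [id, add_sub_cancel_left] at key
  rwa [integral_gaussLogPDF_sub_integral_gaussLogPDF hr hV hY] at key

end GaussianInformation

section AffineGaussianKernel

/-- The Gaussian test channel `X = a S + G`, where `G ∼ N(0, τ)` is independent of `S`. -/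
def affineGaussianKernel (a : ℝ) (τ : ℝ≥0) : Kernel ℝ ℝ where
  toFun s := gaussianReal (a * s) τ
  measurable' := by
    have hargs : Measurable fun s : ℝ => (a * s, τ) := by fun_prop
    exact measurable_gaussianReal.comp hargs

instance (a : ℝ) (τ : ℝ≥0) : IsMarkovKernel (affineGaussianKernel a τ) :=
  ⟨fun s => inferInstanceAs (IsProbabilityMeasure (gaussianReal (a * s) τ))⟩

lemma measurePreserving_compProd_affineGaussianKernel (μ : Measure ℝ) [SFinite μ] (a : ℝ)
    (τ : ℝ≥0) :
    MeasurePreserving (fun p : ℝ × ℝ => (p.1, p.2 - a * p.1)) (μ ⊗ₘ affineGaussianKernel a τ)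
      (μ.prod (gaussianReal 0 τ)) := by
  refine ⟨by fun_prop, Measure.ext_of_lintegral _ fun F hF => ?_⟩
  have hF' : Measurable fun p : ℝ × ℝ => F (p.1, p.2 - a * p.1) := by fun_prop
  have hfiber : ∀ s, ∫⁻ x, F (s, x - a * s) ∂(gaussianReal (a * s) τ) =
      ∫⁻ g, F (s, g) ∂(gaussianReal 0 τ) := fun s => by
    have hFs : Measurable fun g => F (s, g) := by fun_prop
    have hshift : (gaussianReal (a * s) τ).map (fun x => x - a * s) = gaussianReal 0 τ := by
      rw [gaussianReal_map_sub_const, sub_self]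
    rw [← hshift, lintegral_map hFs (by fun_prop)]
  rw [lintegral_map hF (by fun_prop), Measure.lintegral_compProd hF',
    lintegral_prod _ hF.aemeasurable]
  exact lintegral_congr hfiber

end AffineGaussianKernel

section SingleLetter

@[fun_prop]
lemma measurable_state : Measurable state := by
  unfold state
  fun_prop

@[fun_prop]
lemma measurable_inp₁ : Measurable inp₁ := by
  unfold inp₁
  fun_prop

@[fun_prop]
lemma measurable_inp₂ : Measurable inp₂ := by
  unfold inp₂
  fun_prop

/-- The part `X₁ - a S` of the first input that the Gaussian test channel with slope `a` adds
independently of the state. -/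
def innovation (a : ℝ) (ω : ((ℝ × ℝ) × ℝ) × ℝ) : ℝ := inp₁ ω - a * state ω

@[fun_prop]
lemma measurable_innovation (a : ℝ) : Measurable (innovation a) := by
  unfold innovation
  fun_prop

lemma inp₁_eq (a : ℝ) (ω : ((ℝ × ℝ) × ℝ) × ℝ) : inp₁ ω = a * state ω + innovation a ω := by
  rw [innovation, add_sub_cancel]

variable (Q τ : ℝ≥0) (a : ℝ) (ν : Measure ℝ) [IsProbabilityMeasure ν]

lemma measurePreserving_letter :
    MeasurePreserving (fun ω => (((state ω, innovation a ω), inp₂ ω), noise ω))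
      (letterLaw Q (affineGaussianKernel a τ) ν)
      ((((gaussianReal 0 Q).prod (gaussianReal 0 τ)).prod ν).prod (gaussianReal 0 1)) :=
  ((measurePreserving_compProd_affineGaussianKernel _ a τ).prod (.id ν)).prod (.id _)

lemma indepFun_inputs_noise :
    (fun ω => ((state ω, innovation a ω), inp₂ ω))
      ⟂ᵢ[letterLaw Q (affineGaussianKernel a τ) ν] noise :=
  indepFun_of_measurePreserving_prodMk (measurePreserving_letter Q τ a ν)

lemma indepFun_state_innovation_inp₂_noise :
    (fun ω => (state ω, innovation a ω))
      ⟂ᵢ[letterLaw Q (affineGaussianKernel a τ) ν] (fun ω => (inp₂ ω, noise ω)) :=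
  indepFun_of_measurePreserving_prodMk
    ((measurePreserving_prodAssoc _ _ _).comp (measurePreserving_letter Q τ a ν))

lemma indepFun_inp₂_state_innovation_noise :
    inp₂ ⟂ᵢ[letterLaw Q (affineGaussianKernel a τ) ν]
      (fun ω => ((state ω, innovation a ω), noise ω)) :=
  (indepFun_of_measurePreserving_prodMk
    (measurePreserving_prod_right_comm.comp (measurePreserving_letter Q τ a ν))).symm

lemma indepFun_state_inp₂_innovation_noise :
    (fun ω => (state ω, inp₂ ω))
      ⟂ᵢ[letterLaw Q (affineGaussianKernel a τ) ν] (fun ω => (innovation a ω, noise ω)) :=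
  indepFun_of_measurePreserving_prodMk ((measurePreserving_prodAssoc _ _ _).comp
    ((measurePreserving_prod_right_comm.prod (.id _)).comp (measurePreserving_letter Q τ a ν)))

lemma hasLaw_state : HasLaw state (gaussianReal 0 Q) (letterLaw Q (affineGaussianKernel a τ) ν) :=
  (measurePreserving_fst.comp (measurePreserving_fst.comp
    (measurePreserving_fst.comp (measurePreserving_letter Q τ a ν)))).hasLaw

lemma hasLaw_innovation :
    HasLaw (innovation a) (gaussianReal 0 τ) (letterLaw Q (affineGaussianKernel a τ) ν) :=
  (measurePreserving_snd.comp (measurePreserving_fst.comp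
    (measurePreserving_fst.comp (measurePreserving_letter Q τ a ν)))).hasLaw

lemma hasLaw_inp₂ : HasLaw inp₂ ν (letterLaw Q (affineGaussianKernel a τ) ν) :=
  (measurePreserving_snd.comp
    (measurePreserving_fst.comp (measurePreserving_letter Q τ a ν))).hasLaw

lemma hasLaw_noise :
    HasLaw noise (gaussianReal 0 1) (letterLaw Q (affineGaussianKernel a τ) ν) :=
  (measurePreserving_snd.comp (measurePreserving_letter Q τ a ν)).hasLaw

lemma indepFun_state_innovation :
    state ⟂ᵢ[letterLaw Q (affineGaussianKernel a τ) ν] innovation a :=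
  (indepFun_state_inp₂_innovation_noise Q τ a ν).comp measurable_fst measurable_fst

lemma hasLaw_const_mul_state_add_innovation (b : ℝ) :
    HasLaw (fun ω => b * state ω + innovation a ω)
      (gaussianReal 0 (.mk (b ^ 2) (sq_nonneg _) * Q + τ))
      (letterLaw Q (affineGaussianKernel a τ) ν) := by
  have hstate := gaussianReal_const_mul (hasLaw_state Q τ a ν) b
  rw [mul_zero] at hstate
  exact hasLaw_add_gaussianReal hstate (hasLaw_innovation Q τ a ν)
    ((indepFun_state_innovation Q τ a ν).comp (measurable_const_mul b) measurable_id)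

lemma lintegral_inp₁_sq :
    ∫⁻ ω, ENNReal.ofReal (inp₁ ω ^ 2) ∂(letterLaw Q (affineGaussianKernel a τ) ν) =
      ENNReal.ofReal (a ^ 2 * Q + τ) := by
  have h := hasLaw_const_mul_state_add_innovation Q τ a ν a
  simp only [← inp₁_eq] at h
  rw [lintegral_ofReal_sq_of_hasLaw_gaussianReal h, ← ENNReal.ofReal_coe_nnreal]
  rfl

lemma le_condMutualInfo_inp₁ :
    ENNReal.ofReal (awgnCapacity τ) ≤ condMutualInfo inp₁ out (fun ω => (inp₂ ω, state ω))
      (letterLaw Q (affineGaussianKernel a τ) ν) := by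
  have hnoise : (fun ω => ((inp₂ ω, state ω), inp₁ ω))
      ⟂ᵢ[letterLaw Q (affineGaussianKernel a τ) ν] noise := by
    have h := (indepFun_inputs_noise Q τ a ν).comp
      (φ := fun p => ((p.2, p.1.1), a * p.1.1 + p.1.2)) (ψ := id) (by fun_prop) measurable_id
    simpa only [Function.comp_def, ← inp₁_eq, id] using h
  have hresidual : (fun ω => (inp₂ ω, state ω))
      ⟂ᵢ[letterLaw Q (affineGaussianKernel a τ) ν] fun ω => noise ω + innovation a ω :=
    (indepFun_state_inp₂_innovation_noise Q τ a ν).comp (φ := Prod.swap)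
      (ψ := fun p : ℝ × ℝ => p.2 + p.1) measurable_swap (by fun_prop)
  have hinnovation : noise ⟂ᵢ[letterLaw Q (affineGaussianKernel a τ) ν] innovation a :=
    (indepFun_inputs_noise Q τ a ν).symm.comp (φ := id)
      (ψ := fun p : (ℝ × ℝ) × ℝ => p.1.2) measurable_id (by fun_prop)
  have hlaw := hasLaw_add_gaussianReal (hasLaw_noise Q τ a ν) (hasLaw_innovation Q τ a ν)
    hinnovation
  have hout : ∀ ω, out ω = inp₁ ω + inp₂ ω + state ω + noise ω := fun _ => rfl
  have hout' : ∀ ω, out ω = a * state ω + inp₂ ω + state ω + (noise ω + innovation a ω) :=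
    fun ω => by rw [hout, inp₁_eq a]; ring
  simpa only [NNReal.coe_one, div_one] using le_condMutualInfo_of_gaussian_noise
    (by fun_prop) (by fun_prop) one_ne_zero (hasLaw_noise Q τ a ν) hlaw hnoise hresidual
    (f := fun p => p.2 + p.1.1 + p.1.2) (by fun_prop)
    (g := fun p => a * p.2 + p.1 + p.2) (by fun_prop) hout hout'

lemma le_condMutualInfo_inp₂ (P : ℝ≥0) :
    ENNReal.ofReal (awgnCapacity P) ≤ condMutualInfo inp₂ out (fun ω => (inp₁ ω, state ω))
      (letterLaw Q (affineGaussianKernel a τ) (gaussianReal 0 P)) := by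
  have hnoise : (fun ω => ((inp₁ ω, state ω), inp₂ ω))
      ⟂ᵢ[letterLaw Q (affineGaussianKernel a τ) (gaussianReal 0 P)] noise := by
    have h := (indepFun_inputs_noise Q τ a (gaussianReal 0 P)).comp
      (φ := fun p => ((a * p.1.1 + p.1.2, p.1.1), p.2)) (ψ := id) (by fun_prop) measurable_id
    simpa only [Function.comp_def, ← inp₁_eq, id] using h
  have hresidual : (fun ω => (inp₁ ω, state ω))
      ⟂ᵢ[letterLaw Q (affineGaussianKernel a τ) (gaussianReal 0 P)]
        fun ω => noise ω + inp₂ ω := by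
    have h := (indepFun_state_innovation_inp₂_noise Q τ a (gaussianReal 0 P)).comp
      (φ := fun p => (a * p.1 + p.2, p.1)) (ψ := fun p => p.2 + p.1) (by fun_prop) (by fun_prop)
    simpa only [Function.comp_def, ← inp₁_eq] using h
  have hinp₂ : noise ⟂ᵢ[letterLaw Q (affineGaussianKernel a τ) (gaussianReal 0 P)] inp₂ :=
    (indepFun_inputs_noise Q τ a _).symm.comp (φ := id) (ψ := Prod.snd) measurable_id
      measurable_snd
  have hlaw := hasLaw_add_gaussianReal (hasLaw_noise Q τ a _) (hasLaw_inp₂ Q τ a _) hinp₂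
  have hout : ∀ ω, out ω = inp₁ ω + inp₂ ω + state ω + noise ω := fun _ => rfl
  simpa only [NNReal.coe_one, div_one] using le_condMutualInfo_of_gaussian_noise
    (by fun_prop) (by fun_prop) one_ne_zero (hasLaw_noise Q τ a _) hlaw hnoise hresidual
    (f := fun p => p.1.1 + p.2 + p.1.2) (by fun_prop) (g := fun p => p.1 + p.2) (by fun_prop)
    hout fun ω => by rw [hout]; ring

lemma mutualInfo_inp₂ (P : ℝ≥0) :
    mutualInfo inp₂ out (letterLaw Q (affineGaussianKernel a τ) (gaussianReal 0 P)) =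
      ENNReal.ofReal (awgnCapacity (P / (1 + τ + (1 + a) ^ 2 * Q))) := by
  let interference ω := noise ω + ((1 + a) * state ω + innovation a ω)
  have hmix : noise ⟂ᵢ[letterLaw Q (affineGaussianKernel a τ) (gaussianReal 0 P)]
      fun ω => (1 + a) * state ω + innovation a ω :=
    (indepFun_inputs_noise Q τ a _).symm.comp (φ := id)
      (ψ := fun p : (ℝ × ℝ) × ℝ => (1 + a) * p.1.1 + p.1.2) measurable_id (by fun_prop)
  have hinp₂ : inp₂ ⟂ᵢ[letterLaw Q (affineGaussianKernel a τ) (gaussianReal 0 P)]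
      interference :=
    (indepFun_inp₂_state_innovation_noise Q τ a _).comp (φ := id)
      (ψ := fun p : (ℝ × ℝ) × ℝ => p.2 + ((1 + a) * p.1.1 + p.1.2)) measurable_id (by fun_prop)
  have hlaw : HasLaw interference _ _ := hasLaw_add_gaussianReal
    (hasLaw_noise Q τ a (gaussianReal 0 P)) (hasLaw_const_mul_state_add_innovation Q τ a _ _) hmix
  have hout : out = fun ω => inp₂ ω + interference ω := by
    ext ω
    simp only [out, inp₁_eq a, interference]
    ring
  have hvar : ((1 + (.mk ((1 + a) ^ 2) (sq_nonneg _) * Q + τ) : ℝ≥0) : ℝ) =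
      1 + τ + (1 + a) ^ 2 * Q := by
    push_cast [NNReal.coe_mk]
    ring
  rw [hout, mutualInfo_add_gaussian_noise (by positivity) (hasLaw_inp₂ Q τ a _) hlaw hinp₂, hvar]

end SingleLetter

section Region

variable {P₁ P₂ Q τ : ℝ≥0} {a : ℝ} {R : ℝ × ℝ}

lemma mem_outerRegion_of_le (hR : 0 ≤ R) (hpower : a ^ 2 * Q + τ ≤ P₁)
    (h₁ : R.1 ≤ awgnCapacity τ) (h₂ : R.2 ≤ awgnCapacity P₂)
    (h₁₂ : R.1 + R.2 ≤ awgnCapacity τ + awgnCapacity (P₂ / (1 + τ + (1 + a) ^ 2 * Q))) :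
    R ∈ outerRegion P₁ P₂ Q := by
  refine ⟨hR.1, hR.2, affineGaussianKernel a τ, inferInstance, gaussianReal 0 P₂, inferInstance,
    ?_, ?_, ?_, ?_, ?_⟩
  · rw [lintegral_inp₁_sq, ← ENNReal.ofReal_coe_nnreal]
    exact ENNReal.ofReal_le_ofReal hpower
  · exact (lintegral_ofReal_sq_of_hasLaw_gaussianReal (hasLaw_inp₂ Q τ a _)).le
  · exact (ENNReal.ofReal_le_ofReal h₁).trans (le_condMutualInfo_inp₁ Q τ a _)
  · exact (ENNReal.ofReal_le_ofReal h₂).trans (le_condMutualInfo_inp₂ Q τ a P₂)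
  · rw [mutualInfo_inp₂]
    exact (ENNReal.ofReal_le_ofReal h₁₂).trans
      (ENNReal.ofReal_add_le.trans (add_le_add_left (le_condMutualInfo_inp₁ Q τ a _) _))

lemma awgnCapacity_le_awgnCapacity {s t : ℝ} (hs : 0 ≤ s) (hst : s ≤ t) :
    awgnCapacity s ≤ awgnCapacity t := by
  unfold awgnCapacity
  gcongr

lemma gaussRegion_inter_Ici_subset_outerRegion :
    gaussRegion P₁ P₂ Q ∩ Set.Ici 0 ⊆ outerRegion P₁ P₂ Q := by
  rintro R ⟨⟨ρ, hρ, h₁, h₂, h₁₂⟩, hR⟩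
  have hτ : 0 ≤ P₁ - ρ ^ 2 := sub_nonneg.2 hρ
  rcases eq_or_ne Q 0 with rfl | hQ
  · have hcapacity : awgnCapacity (P₁ - ρ ^ 2) ≤ awgnCapacity P₁ :=
      awgnCapacity_le_awgnCapacity hτ (sub_le_self _ (sq_nonneg ρ))
    refine mem_outerRegion_of_le (a := 0) (τ := P₁) hR (by simp) (h₁.trans hcapacity) h₂ ?_
    rw [NNReal.coe_zero, Real.sqrt_zero, add_zero, add_assoc, sub_add_cancel] at h₁₂
    rw [NNReal.coe_zero, mul_zero, add_zero]
    exact h₁₂.trans (add_le_add_left hcapacity _)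
  · have hQpos : (0 : ℝ) < √(Q : ℝ) := Real.sqrt_pos.2 (NNReal.coe_pos.2 (pos_iff_ne_zero.2 hQ))
    have hslope : ∀ b, (b / √(Q : ℝ)) ^ 2 * Q = b ^ 2 := fun b => by
      rw [div_pow, Real.sq_sqrt Q.coe_nonneg, div_mul_cancel₀ _ (NNReal.coe_ne_zero.2 hQ)]
    have hmix : 1 + ρ / √(Q : ℝ) = (ρ + √Q) / √Q := by
      rw [add_div, div_self hQpos.ne', add_comm]
    lift (P₁ : ℝ) - ρ ^ 2 to ℝ≥0 using hτ with τ hτP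
    refine mem_outerRegion_of_le (a := ρ / √Q) (τ := τ) hR ?_ h₁ h₂ ?_
    · rw [hslope, hτP, add_sub_cancel]
    · rwa [hmix, hslope]

end Region

end DirtyMAC

end

/-- The capacity region of the dirty multiple-access channel without degraded message sets is
contained in the single-letter region. -/
theorem proposition1 (P₁ P₂ Q : NNReal) :
    DirtyMAC.capacityRegion P₁ P₂ Q ⊆ DirtyMAC.outerRegion P₁ P₂ Q :=
  (Set.subset_inter (DirtyMAC.capacityRegion_subset_gaussRegion P₁ P₂ Q)
    (DirtyMAC.capacityRegion_subset_Ici P₁ P₂ Q)).trans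
    DirtyMAC.gaussRegion_inter_Ici_subset_outerRegion
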